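/- Let $n\ge 1$, let $\mathbb B^n$ be the open Euclidean unit ball of $\mathbb C^n$, and let $\mathrm{Hol}(\mathbb B^n,\mathbb C^n)$ be the space of holomorphic maps $\mathbb B^n\to\mathbb C^n$ with the topology of uniform convergence on compacta. **The class $S^0$.** Let $S$ be the set of injective $f\in\mathrm{Hol}(\mathbb B^n,\mathbb C^n)$ with $f(0)=0$, $df_0=\mathrm{id}$, and let $\mathcal M$ be the set of $h\in\mathrm{Hol}(\mathbb B^n,\mathbb C^n)$ with $h(0)=0$, $dh_0=\mathrm{id}$ and $\operatorname{Re}\langle h(z),z\rangle>0$ for all $z\in\mathbb B^n\setminus\{0\}$. A Herglotz vector field (associated with $\mathcal M$) is a map $G:\mathbb B^n\times[0,\infty)\to\mathbb C^n$ such that $G(z,\cdot)$ is measurable for all $z\in\mathbb B^n$ and $-G(\cdot,t)\in\mathcal M$ for a.e. $t\ge 0$. Then $S^0$ is the set of maps $f\in S$ with parametric representation: there are a Herglotz vector field $G$ and a map $\varphi:\mathbb B^n\times[0,\infty)\to\mathbb B^n$, locally absolutely continuous in $t$ for each $z$, such that $\varphi(z,0)=z$ for all $z\in\mathbb B^n$,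 $\frac{\partial\varphi}{\partial t}(z,t)=G(\varphi(z,t),t)$ for a.e. $t\ge 0$ and all $z\in\mathbb B^n$, and $f(z)=\lim_{t\to\infty}e^t\varphi(z,t)$ locally uniformly on $\mathbb B^n$. **Loewner chains.** A normalized Loewner chain is a family $(f_t)_{t\ge0}$ of injective maps in $\mathrm{Hol}(\mathbb B^n,\mathbb C^n)$ with $f_t(0)=0$, $d(f_t)_0=e^t\,\mathrm{id}$ for all $t\ge0$, such that for all $0\le s\le t$ there is a holomorphic $\varphi_{s,t}:\mathbb B^n\to\mathbb B^n$ with $\varphi_{s,t}(0)=0$ and $f_s=f_t\circ\varphi_{s,t}$. It is a normal Loewner chain if $\{e^{-t}f_t\}_{t\ge0}$ is a normal family. For $0\le T_1<T_2\le\infty$, it is exponentially squeezing in $[T_1,T_2)$ if there is $a\in(0,1]$ such that $$\|f_t^{-1}(f_s(z))\|\le e^{a(s-t)}\|z\|\qquad\text{for all } T_1\le s<t<T_2 \text{ and all } z\in\mathbb B^n.$$ **Support and extreme points.** A map $f\in S^0$ is a support point of $S^0$ if there is a continuous complex-linear functional $L:\mathrm{Hol}(\mathbb B^n,\mathbb C^n)\to\mathbb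 C$, not constant on $S^0$, with $\operatorname{Re}L(f)=\max_{g\in S^0}\operatorname{Re}L(g)$. It is an extreme point of $S^0$ if $f=\lambda g+(1-\lambda)h$ with $\lambda\in(0,1)$ and $g,h\in S^0$ implies $f=g=h$. **Proposition.** Let $(f_t)_{t\ge0}$ be a normal Loewner chain on $\mathbb B^n$ which is exponentially squeezing in $[T_1,T_2)$ for some $0\le T_1<T_2\le+\infty$. Then $f_0$ is not a support point of $S^0$, and $f_0$ is not an extreme point of $S^0$. -/

import Mathlib

open Set Filter Topology MeasureTheory
open scoped NNReal ENNReal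

/-- The complex Euclidean space `ℂⁿ`. -/
abbrev Cn (n : ℕ) : Type := EuclideanSpace ℂ (Fin n)

/-- The open Euclidean unit ball of `ℂⁿ`. -/
abbrev unitBall (n : ℕ) : Set (Cn n) := Metric.ball (0 : Cn n) 1

/-- Extension by zero of a map on the unit ball to all of `ℂⁿ`
(only its values and derivatives inside the open ball are ever used). -/
noncomputable def zeroExt {n : ℕ} (f : unitBall n → Cn n) : Cn n → Cn n :=
  Function.extend Subtype.val f 0

theorem zeroExt_apply {n : ℕ} (f : unitBall n → Cn n) (z : unitBall n) :
    zeroExt f (z : Cn n) = f z :=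
  Subtype.val_injective.extend_apply f 0 z

theorem zeroExt_eqOn {n : ℕ} {f : unitBall n → Cn n} {F : Cn n → Cn n}
    (h : ∀ z : unitBall n, f z = F z) : EqOn (zeroExt f) F (unitBall n) :=
  fun z hz => (zeroExt_apply f ⟨z, hz⟩).trans (h ⟨z, hz⟩)

/-- `Hol(𝔹ⁿ, ℂⁿ)`: the complex vector space of holomorphic maps from the unit ball to `ℂⁿ`.
It is a subspace of the space of continuous maps with the compact-open topology, so its
topology is that of uniform convergence on compact subsets of the ball. -/
def Hol (n : ℕ) : Submodule ℂ C(unitBall n, Cn n) where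
  carrier := {f | DifferentiableOn ℂ (zeroExt f) (unitBall n)}
  zero_mem' := (differentiableOn_const (0 : Cn n)).congr (zeroExt_eqOn fun _ => rfl)
  add_mem' := fun {f g} hf hg => (DifferentiableOn.add hf hg).congr
    (zeroExt_eqOn fun z => by simp [zeroExt_apply])
  smul_mem' := fun c f hf => (DifferentiableOn.const_smul hf c).congr
    (zeroExt_eqOn fun z => by simp [zeroExt_apply])

/-- A holomorphic map on the ball, as a function on `ℂⁿ` (zero outside the ball). -/
noncomputable def Hol.toFun {n : ℕ} (f : Hol n) : Cn n → Cn n := zeroExt (f : C(unitBall n, Cn n))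

noncomputable instance {n : ℕ} : CoeFun (Hol n) (fun _ => Cn n → Cn n) := ⟨Hol.toFun⟩

/-- The class `S`: injective holomorphic maps on the ball with `f 0 = 0` and `df₀ = id`. -/
def classS (n : ℕ) : Set (Hol n) :=
  {f | f 0 = 0 ∧ HasFDerivAt (𝕜 := ℂ) f (ContinuousLinearMap.id ℂ (Cn n)) 0 ∧
    InjOn f (unitBall n)}

/-- The class `ℳ`: holomorphic `h` on the ball with `h 0 = 0`, `dh₀ = id` and
`Re ⟨h z, z⟩ > 0` for `z ≠ 0` in the ball. -/
def classM (n : ℕ) : Set (Hol n) :=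
  {h | h 0 = 0 ∧ HasFDerivAt (𝕜 := ℂ) h (ContinuousLinearMap.id ℂ (Cn n)) 0 ∧
    ∀ z ∈ unitBall n, z ≠ 0 → 0 < (inner ℂ (h z) z).re}

/-- `G z t`, for `z` in the ball and `t ≥ 0`, is a Herglotz vector field associated with `ℳ`:
each `G z` is Lebesgue measurable on `[0, ∞)`, and `-G(·, t)` belongs to `ℳ` for a.e. `t ≥ 0`. -/
def IsHerglotz {n : ℕ} (G : Cn n → ℝ → Cn n) : Prop :=
  (∀ z ∈ unitBall n, AEMeasurable (G z) (volume.restrict (Ici 0))) ∧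
  ∀ᵐ t ∂(volume.restrict (Ici (0 : ℝ))), ∃ h ∈ classM n, ∀ z ∈ unitBall n, -G z t = h z

/-- `φ z t` solves the Loewner equation driven by `G` on `𝔹ⁿ × [0, ∞)` with `φ z 0 = z`, in the
sense of Carathéodory: each `φ z` stays in the ball and is locally absolutely continuous on
`[0, ∞)`, and `∂φ/∂t (z, t) = G (φ z t) t` for a.e. `t ≥ 0` and all `z` in the ball. -/
def SolvesLoewnerODE {n : ℕ} (G φ : Cn n → ℝ → Cn n) : Prop :=
  (∀ z ∈ unitBall n, φ z 0 = z) ∧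
  (∀ z ∈ unitBall n, ∀ t, 0 ≤ t → φ z t ∈ unitBall n) ∧
  (∀ z ∈ unitBall n, ∀ T, 0 ≤ T → AbsolutelyContinuousOnInterval (φ z) 0 T) ∧
  ∀ᵐ t ∂(volume.restrict (Ici (0 : ℝ))), ∀ z ∈ unitBall n, HasDerivAt (φ z) (G (φ z t) t) t

/-- `f` admits parametric representation: `f = lim e^t φ(·, t)` locally uniformly on the ball,
as `t → ∞`, for the solution `φ` of the Loewner equation of some Herglotz vector field. -/
def HasParametricRepresentation {n : ℕ} (f : Hol n) : Prop :=
  ∃ G φ : Cn n → ℝ → Cn n, IsHerglotz G ∧ SolvesLoewnerODE G φ ∧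
    TendstoLocallyUniformlyOn (fun (t : ℝ) (z : Cn n) => Real.exp t • φ z t) f atTop (unitBall n)

/-- The class `S⁰` of maps in `S` admitting parametric representation. -/
def classS0 (n : ℕ) : Set (Hol n) := {f | f ∈ classS n ∧ HasParametricRepresentation f}

/-- Normalized subordination chains `(f_t)_{t ≥ 0}`. -/
def IsNormalizedSubordinationChain {n : ℕ} (f : ℝ≥0 → Hol n) : Prop :=
  (∀ t, f t 0 = 0 ∧
    HasFDerivAt (𝕜 := ℂ) (f t) (Real.exp t • ContinuousLinearMap.id ℂ (Cn n)) 0) ∧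
  ∀ s t, s ≤ t → ∃ φ : Hol n, MapsTo φ (unitBall n) (unitBall n) ∧ φ 0 = 0 ∧
    ∀ z ∈ unitBall n, f s z = f t (φ z)

/-- Normalized Loewner chains: normalized subordination chains of injective maps. -/
def IsNormalizedLoewnerChain {n : ℕ} (f : ℝ≥0 → Hol n) : Prop :=
  IsNormalizedSubordinationChain f ∧ ∀ t, InjOn (f t) (unitBall n)

/-- Normal families: every sequence in the family has a subsequence that converges in
`Hol(𝔹ⁿ, ℂⁿ)`, i.e. uniformly on compact subsets of the ball. -/
def IsNormalFamily {n : ℕ} (F : Set (Hol n)) : Prop :=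
  ∀ u : ℕ → Hol n, (∀ k, u k ∈ F) →
    ∃ g : Hol n, ∃ σ : ℕ → ℕ, StrictMono σ ∧ Tendsto (u ∘ σ) atTop (𝓝 g)

/-- Normal Loewner chains: normalized Loewner chains with `{e^{-t} f_t : t ≥ 0}` normal. -/
def IsNormalLoewnerChain {n : ℕ} (f : ℝ≥0 → Hol n) : Prop :=
  IsNormalizedLoewnerChain f ∧ IsNormalFamily (range fun t : ℝ≥0 => Real.exp (-(t : ℝ)) • f t)

/-- The chain is exponentially squeezing in `[T₁, T₂)`: for some `a ∈ (0, 1]` one has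
`‖f_t⁻¹(f_s(z))‖ ≤ e^{a(s-t)} ‖z‖` for all `T₁ ≤ s < t < T₂` and all `z` in the ball. The point
`w` below is `f_t⁻¹(f_s(z))`, which is unique since the maps of a Loewner chain are injective. -/
def IsExponentiallySqueezing {n : ℕ} (f : ℝ≥0 → Hol n) (T₁ : ℝ≥0) (T₂ : ℝ≥0∞) : Prop :=
  ∃ a : ℝ, 0 < a ∧ a ≤ 1 ∧ ∀ s t : ℝ≥0, T₁ ≤ s → s < t → (t : ℝ≥0∞) < T₂ →
    ∀ z ∈ unitBall n, ∃ w ∈ unitBall n, f t w = f s z ∧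
      ‖w‖ ≤ Real.exp (a * ((s : ℝ) - (t : ℝ))) * ‖z‖

/-- Support points of a set `A` of holomorphic maps: elements of `A` at which the real part of
some continuous complex-linear functional, not constant on `A`, attains its maximum over `A`. -/
def supportPoints {n : ℕ} (A : Set (Hol n)) : Set (Hol n) :=
  {f | f ∈ A ∧ ∃ L : Hol n →L[ℂ] ℂ, (∃ g ∈ A, ∃ h ∈ A, L g ≠ L h) ∧
    ∀ g ∈ A, (L g).re ≤ (L f).re}

/-!
The maps `f 0 + ε • (g ∘ φ)`, where `φ = f_U⁻¹ ∘ f_0` for a suitable time `U`, belong to `S⁰` for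
every holomorphic `g` of order at least two at the origin and every small complex `ε`. Hence `f 0`
is interior to a segment in `S⁰`, and no functional can have a nontrivial maximum there.

*Membership in `S⁰`.* Any normalized Loewner chain `F` for which `e^{-t} F_t` is bounded near the
origin for large `t` starts at an element of `S⁰` (`IsLoewnerChain.mem_classS0`). The Schwarz lemma
and a Harnack type inequality give `‖z - φ_{s,t}(z)‖ ≤ C (t - s)` for the transition maps
`φ_{s,t} = F_t⁻¹ ∘ F_s`, with `C` locally uniform in `z`. So the trajectories are Lipschitz, and
differentiable at almost every time for a dense set of starting points; equi-Lipschitz bounds extend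
this to all starting points, and the derivatives form the Herglotz vector field
(`IsLoewnerChain.exists_isHerglotz_solvesLoewnerODE`).

*Perturbation.* Exponential squeezing with exponent `a` from time `T` on makes it possible to run the
chain faster by the factor `1 + a` while dilating by `e^{a (s - T)}`: the dilated transition maps are
still self-maps of the ball. At time `A` this exhibits `f_0` as the composition of the map
`f_U(e^{-b} ·)`, where `b = a (A - T)` and `U = A + b`, with a self-map of the ball. Since `f_U` is
only used on the smaller ball of radius `e^{-b}`, it may be replaced there by `f_U + ε g`, which
equals `f_U ∘ (e^{-b} (id + k))` after dilation, with a small Lipschitz map `k`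
(`exists_factor_of_perturbation`). The maps `e^{-x} (id + (x / b) k)`, for `x` from `b` down to `0`,
lead back to the original chain (`subordinate_interpolation`,
`IsLoewnerChain.isLoewnerChain_perturbedChain`).

*Extreme points.* The direction `g(z) = z_i z` gives a nontrivial segment in `S⁰` centred at `f 0`.

*Support points.* If `Re L` is maximal at `f 0`, then `L (g ∘ φ) = 0` for all `g` of order at least
two, since all small complex `ε` are allowed. As in Holmgren's uniqueness theorem, this propagates
backwards in time: the function `s ↦ L (g ∘ φ_{0,s})` vanishes at `U`, and the differences
`g - g ∘ φ_{s,t}` are of order `t - s` on slightly smaller balls, so iteration on a scale of balls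
bounds it by a sequence that tends to zero on a time interval of fixed length. Thus `L` vanishes at
all maps of order at least two (`IsLoewnerChain.apply_eq_zero_of_apply_comp_eq_zero`), in particular
at differences of elements of `S`, so `L` is constant on `S⁰`.
-/

/-! ### Bounded holomorphic maps and holomorphic inverses -/

section Toolkit

theorem exists_norm_le_on_ball_of_continuousAt {E F : Type*} [SeminormedAddCommGroup E]
    [SeminormedAddCommGroup F] {f : E → F} {c : E} {U : Set E} (hU : U ∈ 𝓝 c)
    (hf : ContinuousAt f c) :
    ∃ R > 0, Metric.ball c R ⊆ U ∧ ∀ x ∈ Metric.ball c R, ‖f x‖ ≤ ‖f c‖ + 1 := by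
  have h : ∀ᶠ x in 𝓝 c, x ∈ U ∧ ‖f x‖ ≤ ‖f c‖ + 1 :=
    Filter.Eventually.and hU (hf.norm.eventually (Iic_mem_nhds (lt_add_one _)))
  obtain ⟨R, hR, h⟩ := Metric.eventually_nhds_iff_ball.1 h
  exact ⟨R, hR, fun x hx => (h x hx).1, fun x hx => (h x hx).2⟩

variable {E F : Type*} [NormedAddCommGroup E] [NormedSpace ℂ E]
  [NormedAddCommGroup F] [NormedSpace ℂ F]

theorem norm_fderiv_le_of_norm_le_on_ball {f : E → F} {c : E} {R M : ℝ} (hR : 0 < R)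
    (hf : DifferentiableOn ℂ f (Metric.ball c R)) (hM : ∀ x ∈ Metric.ball c R, ‖f x‖ ≤ M) :
    ‖fderiv ℂ f c‖ ≤ 2 * M / R := by
  refine Complex.norm_fderiv_le_div_of_mapsTo_ball hf (fun x hx => ?_) hR
  rw [mem_closedBall_iff_norm]
  have := hM c (Metric.mem_ball_self hR)
  linarith [norm_sub_le (f x) (f c), hM x hx]

theorem norm_sub_le_of_norm_le_on_ball {f : E → F} {c : E} {R M r : ℝ} (hr : r < R)
    (hf : DifferentiableOn ℂ f (Metric.ball c R)) (hM : ∀ x ∈ Metric.ball c R, ‖f x‖ ≤ M)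
    {x y : E} (hx : x ∈ Metric.closedBall c r) (hy : y ∈ Metric.closedBall c r) :
    ‖f x - f y‖ ≤ 2 * M / (R - r) * ‖x - y‖ := by
  have hsub : ∀ z ∈ Metric.closedBall c r, Metric.ball z (R - r) ⊆ Metric.ball c R := by
    intro z hz
    apply Metric.ball_subset_ball'
    rw [Metric.mem_closedBall] at hz
    linarith
  have h0 : 0 < R - r := by linarith
  let _ : NormedSpace ℝ E := NormedSpace.restrictScalars ℝ ℂ E
  refine (convex_closedBall c r).norm_image_sub_le_of_norm_hasFDerivWithin_le
    (f' := fun z => fderiv ℂ f z) (𝕜 := ℂ) (fun z hz => ?_) (fun z hz => ?_) hy hx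
  · have : z ∈ Metric.ball c R := hsub z hz (Metric.mem_ball_self h0)
    exact ((hf z this).differentiableAt (Metric.isOpen_ball.mem_nhds this)).hasFDerivAt.hasFDerivWithinAt
  · exact norm_fderiv_le_of_norm_le_on_ball h0 (hf.mono (hsub z hz)) fun x hx => hM x (hsub z hz hx)

/-- The Schwarz lemma applied to the first-order Taylor remainder of a bounded holomorphic map. -/
theorem norm_remainder_le_of_norm_le_on_ball {f : E → F} {c : E} {R M : ℝ}
    (hf : DifferentiableOn ℂ f (Metric.ball c R)) (hM : ∀ x ∈ Metric.ball c R, ‖f x‖ ≤ M)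
    {D : E →L[ℂ] F} (hD : HasFDerivAt f D c) {x : E} (hx : x ∈ Metric.ball c R) :
    ‖f x - f c - D (x - c)‖ ≤ 4 * M / R ^ 2 * ‖x - c‖ ^ 2 := by
  have hR : 0 < R := Metric.nonempty_ball.1 ⟨x, hx⟩
  have hc := Metric.mem_ball_self (x := c) hR
  have hDn : ‖D‖ ≤ 2 * M / R := hD.fderiv ▸ norm_fderiv_le_of_norm_le_on_ball hR hf hM
  have key := Complex.dist_le_mul_div_pow_of_mapsTo_ball_of_isLittleO
    (f := fun x => f x - f c - D (x - c)) (c := c) (R₁ := R) (R₂ := 4 * M) (n := 1) (z := x)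
    ?_ ?_ ?_ hx
  · simp only [sub_self, map_zero, dist_zero_right] at key
    rw [dist_eq_norm] at key
    refine key.trans (le_of_eq ?_)
    ring
  · refine (hf.sub_const _).sub ?_
    exact D.differentiable.comp_differentiableOn (differentiableOn_id.sub_const c)
  · intro y hy
    simp only [sub_self, map_zero, mem_closedBall_iff_norm, sub_zero]
    have h1 : ‖D (y - c)‖ ≤ 2 * M := by
      rw [mem_ball_iff_norm] at hy
      calc ‖D (y - c)‖ ≤ 2 * M / R * R :=
            (D.le_opNorm _).trans (mul_le_mul hDn hy.le (norm_nonneg _) ((norm_nonneg _).trans hDn))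
        _ = 2 * M := by field_simp
    linarith [norm_sub_le (f y - f c) (D (y - c)), norm_sub_le (f y) (f c), hM y hy, hM c hc]
  · simpa using hD.isLittleO.norm_right

theorem hasStrictFDerivAt_of_differentiableOn_ball {f : E → F} {c : E} {R M : ℝ} (hR : 0 < R)
    (hf : DifferentiableOn ℂ f (Metric.ball c R)) (hM : ∀ x ∈ Metric.ball c R, ‖f x‖ ≤ M) :
    HasStrictFDerivAt f (fderiv ℂ f c) c := by
  have hM0 : 0 ≤ M := (norm_nonneg _).trans (hM c (Metric.mem_ball_self hR))
  have hD : HasFDerivAt f (fderiv ℂ f c) c :=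
    ((hf c (Metric.mem_ball_self hR)).differentiableAt (Metric.ball_mem_nhds c hR)).hasFDerivAt
  set D := fderiv ℂ f c
  have hbd : ∀ r, 0 < r → 2 * r ≤ R → ∀ x ∈ Metric.closedBall c r, ∀ y ∈ Metric.closedBall c r,
      ‖f x - f y - D (x - y)‖ ≤ (32 * M / R ^ 2 * r) * ‖x - y‖ := by
    intro r hr hrR x hx y hy
    have hs : Metric.ball c (2 * r) ⊆ Metric.ball c R := Metric.ball_subset_ball hrR
    have := norm_sub_le_of_norm_le_on_ball (f := fun x => f x - f c - D (x - c)) (c := c)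
      (R := 2 * r) (r := r) (M := 4 * M / R ^ 2 * (2 * r) ^ 2) (by linarith)
      (((hf.mono hs).sub_const _).sub
        (D.differentiable.comp_differentiableOn (differentiableOn_id.sub_const c)))
      (fun x hx => (norm_remainder_le_of_norm_le_on_ball hf hM hD (hs hx)).trans ?_) hx hy
    · calc _ = ‖f x - f c - D (x - c) - (f y - f c - D (y - c))‖ := by
            congr 1; simp only [map_sub]; abel
        _ ≤ _ := this
        _ = _ := by field_simp; ring
    · rw [mem_ball_iff_norm] at hx
      gcongr
  refine .of_isLittleO (Asymptotics.isLittleO_iff.2 fun ε hε => ?_)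
  obtain ⟨r, hr, hrR, hrε⟩ : ∃ r, 0 < r ∧ 2 * r ≤ R ∧ 32 * M / R ^ 2 * r ≤ ε := by
    have hK : 0 < 32 * M / R ^ 2 + 1 := by positivity
    refine ⟨min (R / 2) (ε / (32 * M / R ^ 2 + 1)), by positivity, ?_, ?_⟩
    · linarith [min_le_left (R / 2) (ε / (32 * M / R ^ 2 + 1))]
    · calc _ ≤ (32 * M / R ^ 2 + 1) * (ε / (32 * M / R ^ 2 + 1)) := by
            gcongr
            · linarith
            · exact min_le_right _ _
        _ = ε := by field_simp
  have h1 := Metric.closedBall_mem_nhds c hr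
  filter_upwards [prod_mem_nhds h1 h1] with p hp
  exact (hbd r hr hrR p.1 hp.1 p.2 hp.2).trans (by gcongr)

theorem DifferentiableOn.hasStrictFDerivAt_complex {f : E → F} {c : E} {U : Set E}
    (hf : DifferentiableOn ℂ f U) (hU : U ∈ 𝓝 c) : HasStrictFDerivAt f (fderiv ℂ f c) c := by
  obtain ⟨R, hR, hs, hM⟩ := exists_norm_le_on_ball_of_continuousAt hU
    (hf.differentiableAt hU).continuousAt
  exact hasStrictFDerivAt_of_differentiableOn_ball hR (hf.mono hs) hM

/-- A pointwise limit of a bounded sequence of holomorphic maps is holomorphic: the first-order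
Taylor expansions hold with a uniform quadratic remainder, so they survive in the limit along any
subsequence along which the derivatives converge. -/
theorem exists_hasFDerivAt_of_tendsto_of_norm_le [FiniteDimensional ℂ E] [FiniteDimensional ℂ F]
    {f : ℕ → E → F} {g : E → F} {c : E} {R M : ℝ} (hR : 0 < R)
    (hf : ∀ k, DifferentiableOn ℂ (f k) (Metric.ball c R))
    (hM : ∀ k, ∀ x ∈ Metric.ball c R, ‖f k x‖ ≤ M)
    (hg : ∀ x ∈ Metric.ball c R, Tendsto (fun k => f k x) atTop (𝓝 (g x))) :
    ∃ (D : E →L[ℂ] F) (σ : ℕ → ℕ), StrictMono σ ∧ HasFDerivAt g D c ∧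
      Tendsto (fun k => fderiv ℂ (f (σ k)) c) atTop (𝓝 D) := by
  have hb : ∀ k, fderiv ℂ (f k) c ∈ Metric.closedBall (0 : E →L[ℂ] F) (2 * M / R) := fun k =>
    mem_closedBall_zero_iff.2 (norm_fderiv_le_of_norm_le_on_ball hR (hf k) (hM k))
  have : ProperSpace (E →L[ℂ] F) := FiniteDimensional.proper ℂ _
  obtain ⟨D, -, σ, hσ, hD⟩ := (isCompact_closedBall (0 : E →L[ℂ] F) (2 * M / R)).tendsto_subseq hb
  refine ⟨D, σ, hσ, ?_, hD⟩
  have hc := Metric.mem_ball_self (x := c) hR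
  have key : ∀ x ∈ Metric.ball c R, ‖g x - g c - D (x - c)‖ ≤ 4 * M / R ^ 2 * ‖x - c‖ ^ 2 := by
    intro x hx
    have h1 : Tendsto (fun k => ‖f (σ k) x - f (σ k) c - fderiv ℂ (f (σ k)) c (x - c)‖) atTop
        (𝓝 ‖g x - g c - D (x - c)‖) := by
      refine ((((hg x hx).comp hσ.tendsto_atTop).sub ((hg c hc).comp hσ.tendsto_atTop)).sub ?_).norm
      exact ((ContinuousLinearMap.apply ℂ F (x - c)).continuous.tendsto D).comp hD
    refine le_of_tendsto h1 (Eventually.of_forall fun k => ?_)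
    refine norm_remainder_le_of_norm_le_on_ball (hf _) (hM _) ?_ hx
    exact ((hf _ c hc).differentiableAt (Metric.ball_mem_nhds c hR)).hasFDerivAt
  refine .of_isLittleO ?_
  have h2 : (fun x => g x - g c - D (x - c)) =O[𝓝 c] fun x => ‖x - c‖ ^ 2 := by
    refine .of_bound (4 * M / R ^ 2) ?_
    filter_upwards [Metric.ball_mem_nhds c hR] with x hx
    simpa using key x hx
  refine h2.trans_isLittleO ?_
  have h3 : Tendsto (fun x => x - c) (𝓝 c) (𝓝 0) := by
    exact (by fun_prop : Continuous fun x : E => x - c).tendsto' c 0 (sub_self c)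
  exact (Asymptotics.isLittleO_norm_pow_id (E' := E) (by norm_num : 1 < 2)).comp_tendsto h3

/-- An injective holomorphic map with injective differentials is a homeomorphism onto an open set
with holomorphic inverse. -/
theorem exists_holomorphic_inverse [FiniteDimensional ℂ E] {q : E → E} {U : Set E}
    (hU : IsOpen U) (hq : DifferentiableOn ℂ q U) (hinj : InjOn q U)
    (hq' : ∀ z ∈ U, Function.Injective (fderiv ℂ q z)) :
    ∃ p : E → E, IsOpen (q '' U) ∧ (∀ z ∈ U, p (q z) = z) ∧ DifferentiableOn ℂ p (q '' U) := by
  have : CompleteSpace E := FiniteDimensional.complete ℂ E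
  have hequiv : ∀ z ∈ U, ∃ e : E ≃L[ℂ] E, HasStrictFDerivAt q (e : E →L[ℂ] E) z := by
    intro z hz
    refine ⟨(LinearEquiv.ofInjectiveEndo (fderiv ℂ q z : E →ₗ[ℂ] E)
      (hq' z hz)).toContinuousLinearEquiv, ?_⟩
    convert hq.hasStrictFDerivAt_complex (hU.mem_nhds hz)
    ext v
    rfl
  refine ⟨Function.invFunOn q U, ?_, fun z hz => hinj.leftInvOn_invFunOn hz, ?_⟩
  · rw [isOpen_iff_mem_nhds]
    rintro _ ⟨z, hz, rfl⟩
    obtain ⟨e, he⟩ := hequiv z hz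
    rw [← he.map_nhds_eq_of_equiv]
    exact image_mem_map (hU.mem_nhds hz)
  · rintro _ ⟨z, hz, rfl⟩
    obtain ⟨e, he⟩ := hequiv z hz
    have h := he.to_local_left_inverse (g := Function.invFunOn q U) <| by
      filter_upwards [hU.mem_nhds hz] with y hy using hinj.leftInvOn_invFunOn hy
    exact h.hasFDerivAt.differentiableAt.differentiableWithinAt

/-- A map that lifts a holomorphic map through an injective holomorphic map with injective
differentials is holomorphic. -/
theorem differentiableOn_of_comp_eq [FiniteDimensional ℂ E] {q : E → E} {U : Set E}
    (hU : IsOpen U) (hq : DifferentiableOn ℂ q U) (hinj : InjOn q U)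
    (hq' : ∀ z ∈ U, Function.Injective (fderiv ℂ q z)) {w f : E → E} {V : Set E}
    (hf : DifferentiableOn ℂ f V) (hw : MapsTo w V U) (hqw : ∀ z ∈ V, q (w z) = f z) :
    DifferentiableOn ℂ w V := by
  obtain ⟨p, -, hp, hpd⟩ := exists_holomorphic_inverse hU hq hinj hq'
  refine (hpd.comp hf fun z hz => ⟨w z, hw hz, hqw z hz⟩).congr fun z hz => ?_
  rw [Function.comp_apply, ← hqw z hz, hp _ (hw hz)]

end Toolkit

/-! ### Holomorphic self-maps of the ball that fix the origin -/

/-- The Schwarz lemma for the Cayley transform of a function with nonnegative real part. -/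
theorem norm_sub_one_le_of_re_nonneg {p : ℂ → ℂ} (hp : DifferentiableOn ℂ p (Metric.ball 0 1))
    (hre : ∀ ζ ∈ Metric.ball (0 : ℂ) 1, 0 ≤ (p ζ).re) (h0 : p 0 = 1) {ζ : ℂ} (hζ : ‖ζ‖ < 1) :
    ‖p ζ - 1‖ ≤ ‖ζ‖ * ‖p ζ + 1‖ := by
  have hne : ∀ ζ ∈ Metric.ball (0 : ℂ) 1, p ζ + 1 ≠ 0 := by
    intro ζ hζ h
    have := congrArg Complex.re h
    simp at this
    linarith [hre ζ hζ]
  have key := Complex.norm_le_norm_of_mapsTo_ball (f := fun ζ => (p ζ - 1) / (p ζ + 1)) (R := 1)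
    ((hp.sub_const 1).div (hp.add_const 1) hne) (fun ζ hζ => ?_) (by simp [h0]) hζ
  · have h1 : 0 < ‖p ζ + 1‖ := norm_pos_iff.2 (hne ζ (by simpa using hζ))
    rwa [norm_div, div_le_iff₀ h1] at key
  · have h1 : 0 < ‖p ζ + 1‖ := norm_pos_iff.2 (hne ζ hζ)
    rw [mem_closedBall_zero_iff, norm_div, div_le_one h1]
    refine abs_le_of_sq_le_sq' ?_ h1.le |>.2
    rw [Complex.sq_norm, Complex.sq_norm, Complex.normSq_apply, Complex.normSq_apply]
    simp only [Complex.sub_re, Complex.one_re, Complex.sub_im, Complex.one_im, sub_zero,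
      Complex.add_re, Complex.add_im, add_zero]
    nlinarith [hre ζ hζ]

theorem norm_le_of_norm_sub_one_le {w : ℂ} {r : ℝ} (hr1 : r < 1) (h : ‖w - 1‖ ≤ r * ‖w + 1‖)
    (hr : 0 ≤ r) : ‖w‖ ≤ (1 + r) / (1 - r) := by
  rw [le_div_iff₀ (by linarith)]
  have h1 : ‖w‖ - 1 ≤ ‖w - 1‖ := by simpa using norm_sub_norm_le w 1
  have h2 : ‖w + 1‖ ≤ ‖w‖ + 1 := by simpa using norm_add_le w 1
  nlinarith

theorem le_re_of_norm_sub_one_le {w : ℂ} {r : ℝ} (hr1 : r < 1) (h : ‖w - 1‖ ≤ r * ‖w + 1‖)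
    (hr : 0 ≤ r) (hw : 0 ≤ w.re) : (1 - r) / (1 + r) ≤ w.re := by
  rw [div_le_iff₀ (by linarith)]
  have h2 : ‖w - 1‖ ^ 2 ≤ r ^ 2 * ‖w + 1‖ ^ 2 := by
    rw [← mul_pow]; exact pow_le_pow_left₀ (norm_nonneg _) h 2
  rw [Complex.sq_norm, Complex.sq_norm, Complex.normSq_apply, Complex.normSq_apply] at h2
  simp only [Complex.sub_re, Complex.one_re, Complex.sub_im, Complex.one_im, sub_zero,
      Complex.add_re, Complex.add_im, add_zero] at h2
  by_contra! hlt
  have h3 : 0 ≤ (1 - r ^ 2) * w.im ^ 2 := by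
    apply mul_nonneg _ (sq_nonneg _)
    nlinarith
  -- the remaining quadratic in `w.re` factors over the two roots `(1 ∓ r) / (1 ± r)`
  have h4 : 0 < ((1 - r) - w.re * (1 + r)) * ((1 + r) - w.re * (1 - r)) := by
    apply mul_pos <;> nlinarith
  nlinarith

section SelfMap

variable {E : Type*} [NormedAddCommGroup E] [InnerProductSpace ℂ E] {φ : E → E} {c : ℝ}

/-- Harnack type bounds for `⟨z, z - φ z⟩`, with the factor `1 - c`: on the complex line through `z`
this is, up to normalization, a holomorphic function `p` with `p 0 = 1` and `Re p ≥ 0`. -/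
theorem inner_sub_selfMap_bounds (hφ : DifferentiableOn ℂ φ (Metric.ball 0 1))
    (hmaps : MapsTo φ (Metric.ball 0 1) (Metric.ball 0 1)) (h0 : φ 0 = 0)
    (hd : HasFDerivAt φ ((c : ℂ) • ContinuousLinearMap.id ℂ E) 0) (hc : c < 1) {z : E}
    (hz : ‖z‖ < 1) :
    (1 - c) * (‖z‖ ^ 2 * ((1 - ‖z‖) / (1 + ‖z‖))) ≤ (inner ℂ z (z - φ z)).re ∧
      ‖inner ℂ z (z - φ z)‖ ≤ (1 - c) * (‖z‖ ^ 2 * ((1 + ‖z‖) / (1 - ‖z‖))) := by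
  rcases eq_or_ne z 0 with rfl | hz0
  · simp
  set r := ‖z‖ with hrdef
  have hr : 0 < r := norm_pos_iff.2 hz0
  set u : E := ((r : ℂ)⁻¹) • z with hu
  have hu1 : ‖u‖ = 1 := by
    rw [hu, norm_smul, norm_inv, Complex.norm_real, norm_norm, ← hrdef, inv_mul_cancel₀ hr.ne']
  have hrC : (r : ℂ) ≠ 0 := by exact_mod_cast hr.ne'
  have hru : (r : ℂ) • u = z := by rw [hu, smul_smul, mul_inv_cancel₀ hrC, one_smul]
  have hball : ∀ ζ ∈ Metric.ball (0 : ℂ) 1, ζ • u ∈ Metric.ball (0 : E) 1 := by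
    intro ζ hζ
    rw [mem_ball_zero_iff] at hζ ⊢
    rwa [norm_smul, hu1, mul_one]
  let ω : ℂ → ℂ := fun ζ => inner ℂ u (φ (ζ • u))
  have hω : DifferentiableOn ℂ ω (Metric.ball 0 1) := by
    have h1 : DifferentiableOn ℂ (fun ζ : ℂ => φ (ζ • u)) (Metric.ball 0 1) :=
      hφ.comp (differentiableOn_id.smul_const u) hball
    exact (innerSL ℂ u).differentiable.comp_differentiableOn h1
  have hω0 : ω 0 = 0 := by simp [ω, h0]
  have hωle : ∀ ζ ∈ Metric.ball (0 : ℂ) 1, ‖ω ζ‖ < 1 := by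
    intro ζ hζ
    calc ‖ω ζ‖ ≤ ‖u‖ * ‖φ (ζ • u)‖ := norm_inner_le_norm _ _
      _ < 1 := by rw [hu1, one_mul]; simpa using hmaps (hball ζ hζ)
  have hωd : deriv ω 0 = c := by
    have h1 : HasDerivAt (fun ζ : ℂ => ζ • u) u 0 := by
      simpa using (hasDerivAt_id (0 : ℂ)).smul_const u
    have h2 : HasFDerivAt φ ((c : ℂ) • ContinuousLinearMap.id ℂ E) ((0 : ℂ) • u) := by
      simpa using hd
    have h3 := h2.comp_hasDerivAt (0 : ℂ) h1
    have h4 := ((innerSL ℂ u).hasFDerivAt (x := φ ((0 : ℂ) • u))).comp_hasDerivAt (0 : ℂ) h3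
    have h5 : HasDerivAt ω (innerSL ℂ u (((c : ℂ) • ContinuousLinearMap.id ℂ E) u)) 0 := h4
    rw [h5.deriv]
    simp [inner_self_eq_norm_sq_to_K, hu1]
  have hm := (Complex.differentiableOn_dslope (Metric.ball_mem_nhds (0 : ℂ) one_pos)).2 hω
  have hm1 : ∀ ζ ∈ Metric.ball (0 : ℂ) 1, ‖dslope ω 0 ζ‖ ≤ 1 := by
    intro ζ hζ
    have := Complex.norm_dslope_le_div_of_mapsTo_ball (R₁ := 1) (R₂ := 1) hω (fun ζ hζ => by
      rw [hω0, mem_closedBall_zero_iff]; exact (hωle ζ hζ).le) hζ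
    simpa using this
  have hc' : 0 < 1 - c := by linarith
  have hcC : ((1 - c : ℝ) : ℂ) ≠ 0 := by exact_mod_cast hc'.ne'
  let p : ℂ → ℂ := fun ζ => ((1 - c : ℝ) : ℂ)⁻¹ * (1 - dslope ω 0 ζ)
  have hre : ∀ ζ ∈ Metric.ball (0 : ℂ) 1, 0 ≤ (p ζ).re := by
    intro ζ hζ
    simp only [p]
    rw [← Complex.ofReal_inv, Complex.re_ofReal_mul]
    have := (Complex.re_le_norm _).trans (hm1 ζ hζ)
    apply mul_nonneg (by positivity)
    simpa using this
  have hp0 : p 0 = 1 := by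
    simp only [p, dslope_same, hωd]
    rw [show (1 : ℂ) - c = ((1 - c : ℝ) : ℂ) by push_cast; rfl, inv_mul_cancel₀ hcC]
  have hrn : ‖(r : ℂ)‖ = r := by rw [Complex.norm_real, Real.norm_of_nonneg hr.le]
  have hrb : (r : ℂ) ∈ Metric.ball (0 : ℂ) 1 := by rwa [mem_ball_zero_iff, hrn]
  have key := norm_sub_one_le_of_re_nonneg (p := p) ((hm.const_sub 1).const_mul _) hre hp0
    (ζ := (r : ℂ)) (by rwa [hrn])
  rw [hrn] at key
  have hpr : inner ℂ z (z - φ z) = (((1 - c) * r ^ 2 : ℝ) : ℂ) * p r := by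
    simp only [p]
    rw [dslope_of_ne _ hrC, slope_def_field, hω0]
    simp only [ω, hru, sub_zero]
    rw [inner_sub_right, inner_self_eq_norm_sq_to_K, ← hrdef]
    have : inner ℂ u (φ z) = (r : ℂ)⁻¹ * inner ℂ z (φ z) := by
      rw [hu, inner_smul_left]; simp
    rw [this]
    push_cast at hcC ⊢
    field_simp
    simp
  have hcr : 0 ≤ (1 - c) * r ^ 2 := by positivity
  rw [hpr]
  refine ⟨?_, ?_⟩
  · rw [Complex.re_ofReal_mul, ← mul_assoc]
    exact mul_le_mul_of_nonneg_left (le_re_of_norm_sub_one_le hz key hr.le (hre _ hrb)) hcr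
  · rw [norm_mul, Complex.norm_real, Real.norm_of_nonneg hcr, ← mul_assoc]
    exact mul_le_mul_of_nonneg_left (norm_le_of_norm_sub_one_le hz key hr.le) hcr

/-- A holomorphic map is controlled by the numbers `⟨x, h x⟩`: on the circle `|ζ| = ρ` the function
`ζ ↦ ζ ⟨z + ζ w, h (z + ζ w)⟩` agrees with a holomorphic function of `ζ` whose value at `0` is
`ρ² ⟨w, h z⟩`. -/
theorem norm_le_of_norm_inner_le {h : E → E} {z : E} {ρ K : ℝ} (hρ : 0 < ρ) {U : Set E}
    (hh : DifferentiableOn ℂ h U) (hU : Metric.closedBall z ρ ⊆ U)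
    (hK : ∀ x ∈ Metric.closedBall z ρ, ‖inner ℂ x (h x)‖ ≤ K) :
    ‖h z‖ ≤ K / ρ := by
  rcases eq_or_ne (h z) 0 with h0 | h0
  · rw [h0, norm_zero]
    exact div_nonneg ((norm_nonneg _).trans (hK z (Metric.mem_closedBall_self hρ.le))) hρ.le
  set w : E := ((‖h z‖ : ℂ)⁻¹) • h z with hw
  have hz0 : 0 < ‖h z‖ := norm_pos_iff.2 h0
  have hw1 : ‖w‖ = 1 := by
    rw [hw, norm_smul, norm_inv, Complex.norm_real, norm_norm, inv_mul_cancel₀ hz0.ne']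
  have hwz : inner ℂ w (h z) = (‖h z‖ : ℂ) := by
    rw [hw, inner_smul_left, inner_self_eq_norm_sq_to_K]
    simp only [map_inv₀, Complex.conj_ofReal]
    have : (‖h z‖ : ℂ) ≠ 0 := by exact_mod_cast hz0.ne'
    simp only [Complex.coe_algebraMap]
    field_simp
  have hmem : ∀ ζ ∈ Metric.closedBall (0 : ℂ) ρ, z + ζ • w ∈ Metric.closedBall z ρ := by
    intro ζ hζ
    rw [mem_closedBall_zero_iff] at hζ
    rw [mem_closedBall_iff_norm, add_sub_cancel_left, norm_smul, hw1, mul_one]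
    exact hζ
  let Ψ : ℂ → ℂ := fun ζ => ζ * inner ℂ z (h (z + ζ • w)) + (ρ : ℂ) ^ 2 * inner ℂ w (h (z + ζ • w))
  have hc : DifferentiableOn ℂ (fun ζ : ℂ => h (z + ζ • w)) (Metric.closedBall 0 ρ) :=
    hh.comp ((differentiableOn_id.smul_const w).const_add z) fun ζ hζ => hU (hmem ζ hζ)
  have hΨ : DifferentiableOn ℂ Ψ (Metric.closedBall 0 ρ) :=
    (differentiableOn_id.mul ((innerSL ℂ z).differentiable.comp_differentiableOn hc)).add
      (((innerSL ℂ w).differentiable.comp_differentiableOn hc).const_mul _)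
  have hcl : closure (Metric.ball (0 : ℂ) ρ) = Metric.closedBall 0 ρ := closure_ball _ hρ.ne'
  have key := Complex.norm_le_of_forall_mem_frontier_norm_le (f := Ψ) (C := ρ * K)
    (U := Metric.ball 0 ρ) Metric.isBounded_ball (by
      refine DifferentiableOn.diffContOnCl ?_
      rwa [hcl]) (fun ζ hζ => ?_) (z := 0) (by
      rw [hcl]; exact Metric.mem_closedBall_self hρ.le)
  · have h1 : Ψ 0 = (ρ : ℂ) ^ 2 * ‖h z‖ := by simp [Ψ, hwz]
    rw [h1, norm_mul, norm_pow, Complex.norm_real, Complex.norm_real, norm_norm,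
      Real.norm_of_nonneg hρ.le] at key
    rw [le_div_iff₀ hρ]
    nlinarith
  · rw [frontier_ball _ hρ.ne', mem_sphere_zero_iff_norm] at hζ
    have h1 : (starRingEnd ℂ) ζ * ζ = (ρ : ℂ) ^ 2 := by
      rw [mul_comm, Complex.mul_conj, Complex.normSq_eq_norm_sq, hζ]; push_cast; rfl
    have h2 : Ψ ζ = ζ * inner ℂ (z + ζ • w) (h (z + ζ • w)) := by
      simp only [Ψ]
      rw [inner_add_left, inner_smul_left w _ ζ, ← h1]
      ring
    rw [h2, norm_mul, hζ]
    exact mul_le_mul_of_nonneg_left (hK _ (hmem ζ (by simp [hζ]))) hρ.le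

/-- A self-map of the ball whose differential at the origin is close to the identity is itself close
to the identity, to the same order. -/
theorem norm_sub_selfMap_le (hφ : DifferentiableOn ℂ φ (Metric.ball 0 1))
    (hmaps : MapsTo φ (Metric.ball 0 1) (Metric.ball 0 1)) (h0 : φ 0 = 0)
    (hd : HasFDerivAt φ ((c : ℂ) • ContinuousLinearMap.id ℂ E) 0) (hc : c < 1) {z : E} {r : ℝ}
    (hz : ‖z‖ ≤ r) (hr : r < 1) :
    ‖z - φ z‖ ≤ (1 - c) * (8 / (1 - r) ^ 2) := by
  have hr' : 0 < 1 - r := by linarith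
  have hsub : ∀ x ∈ Metric.closedBall z ((1 - r) / 2), ‖x‖ ≤ (1 + r) / 2 := by
    intro x hx
    rw [mem_closedBall_iff_norm] at hx
    linarith [norm_le_norm_sub_add x z]
  have key := norm_le_of_norm_inner_le (h := fun z => z - φ z) (z := z) (ρ := (1 - r) / 2)
    (K := (1 - c) * (4 / (1 - r))) (by linarith) (U := Metric.ball 0 1) (differentiableOn_id.sub hφ)
    (fun x hx => by rw [mem_ball_zero_iff]; linarith [hsub x hx]) (fun x hx => ?_)
  · refine key.trans (le_of_eq ?_)
    field_simp
    ring
  · have hx := hsub x hx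
    have hx1 : ‖x‖ < 1 := by linarith
    refine (inner_sub_selfMap_bounds hφ hmaps h0 hd hc hx1).2.trans ?_
    refine mul_le_mul_of_nonneg_left ?_ (by linarith)
    calc ‖x‖ ^ 2 * ((1 + ‖x‖) / (1 - ‖x‖)) ≤ 1 ^ 2 * (2 / ((1 - r) / 2)) := by
          gcongr
          · linarith
          · linarith
      _ = _ := by field_simp; norm_num

end SelfMap

/-! ### Loewner chains and their transition maps -/

/-- Subordination of maps on the ball: `f` factors through `g` by a holomorphic self-map of the
ball that fixes the origin. -/
def Subordinate {n : ℕ} (f g : Cn n → Cn n) : Prop :=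
  ∃ φ : Cn n → Cn n, DifferentiableOn ℂ φ (unitBall n) ∧ MapsTo φ (unitBall n) (unitBall n) ∧
    φ 0 = 0 ∧ ∀ z ∈ unitBall n, f z = g (φ z)

/-- Normalized Loewner chains of maps on the ball, as families of functions on `ℂⁿ` indexed by
real numbers; only the times `t ≥ 0` and the values in the ball matter. -/
structure IsLoewnerChain {n : ℕ} (F : ℝ → Cn n → Cn n) : Prop where
  differentiableOn : ∀ t, 0 ≤ t → DifferentiableOn ℂ (F t) (unitBall n)
  map_zero : ∀ t, 0 ≤ t → F t 0 = 0
  hasFDerivAt : ∀ t, 0 ≤ t →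
    HasFDerivAt (F t) (((Real.exp t : ℝ) : ℂ) • ContinuousLinearMap.id ℂ (Cn n)) 0
  injOn : ∀ t, 0 ≤ t → InjOn (F t) (unitBall n)
  subordinate : ∀ s t, 0 ≤ s → s ≤ t → Subordinate (F s) (F t)

/-- The transition maps `F_t⁻¹ ∘ F_s` of a Loewner chain. -/
noncomputable def transition {n : ℕ} (F : ℝ → Cn n → Cn n) (s t : ℝ) (z : Cn n) : Cn n :=
  Function.invFunOn (F t) (unitBall n) (F s z)

theorem zero_mem_unitBall (n : ℕ) : (0 : Cn n) ∈ unitBall n := Metric.mem_ball_self one_pos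

theorem unitBall_mem_nhds {n : ℕ} {z : Cn n} (hz : z ∈ unitBall n) : unitBall n ∈ 𝓝 z :=
  Metric.isOpen_ball.mem_nhds hz

theorem Subordinate.trans {n : ℕ} {f g h : Cn n → Cn n} (hfg : Subordinate f g)
    (hgh : Subordinate g h) : Subordinate f h := by
  obtain ⟨φ, hφ, hm, h0, he⟩ := hfg
  obtain ⟨ψ, hψ, hm', h0', he'⟩ := hgh
  exact ⟨ψ ∘ φ, hψ.comp hφ hm, hm'.comp hm, by simp [h0, h0'], fun z hz => by
    rw [he z hz, he' _ (hm hz), Function.comp_apply]⟩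

namespace IsLoewnerChain

variable {n : ℕ} {F : ℝ → Cn n → Cn n} {s t u : ℝ} {z : Cn n}

theorem transition_eq (hF : IsLoewnerChain F) (ht : 0 ≤ t) {w : Cn n} (hw : w ∈ unitBall n)
    (h : F t w = F s z) : transition F s t z = w := by
  rw [transition, ← h]
  exact (hF.injOn t ht).leftInvOn_invFunOn hw

theorem exists_transition_eqOn (hF : IsLoewnerChain F) (hs : 0 ≤ s) (hst : s ≤ t) :
    ∃ φ : Cn n → Cn n, EqOn (transition F s t) φ (unitBall n) ∧ DifferentiableOn ℂ φ (unitBall n) ∧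
      MapsTo φ (unitBall n) (unitBall n) ∧ φ 0 = 0 ∧ ∀ z ∈ unitBall n, F s z = F t (φ z) := by
  obtain ⟨φ, hφ, hm, h0, he⟩ := hF.subordinate s t hs hst
  exact ⟨φ, fun z hz => hF.transition_eq (hs.trans hst) (hm hz) (he z hz).symm, hφ, hm, h0, he⟩

theorem transition_differentiableOn (hF : IsLoewnerChain F) (hs : 0 ≤ s) (hst : s ≤ t) :
    DifferentiableOn ℂ (transition F s t) (unitBall n) := by
  obtain ⟨φ, heq, hφ, -⟩ := hF.exists_transition_eqOn hs hst
  exact hφ.congr heq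

theorem transition_mapsTo (hF : IsLoewnerChain F) (hs : 0 ≤ s) (hst : s ≤ t) :
    MapsTo (transition F s t) (unitBall n) (unitBall n) := by
  obtain ⟨φ, heq, -, hm, -⟩ := hF.exists_transition_eqOn hs hst
  exact hm.congr heq.symm

theorem transition_zero (hF : IsLoewnerChain F) (hs : 0 ≤ s) (hst : s ≤ t) :
    transition F s t 0 = 0 := by
  obtain ⟨φ, heq, -, -, h0, -⟩ := hF.exists_transition_eqOn hs hst
  rw [heq (zero_mem_unitBall n), h0]

theorem apply_transition (hF : IsLoewnerChain F) (hs : 0 ≤ s) (hst : s ≤ t)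
    (hz : z ∈ unitBall n) : F t (transition F s t z) = F s z := by
  obtain ⟨φ, heq, -, -, -, he⟩ := hF.exists_transition_eqOn hs hst
  rw [heq hz, he z hz]

theorem transition_self (hF : IsLoewnerChain F) (hs : 0 ≤ s) (hz : z ∈ unitBall n) :
    transition F s s z = z :=
  hF.transition_eq hs hz rfl

theorem transition_transition (hF : IsLoewnerChain F) (hs : 0 ≤ s) (hst : s ≤ t) (htu : t ≤ u)
    (hz : z ∈ unitBall n) : transition F t u (transition F s t z) = transition F s u z := by
  have ht := hs.trans hst
  have h1 := hF.transition_mapsTo hs hst hz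
  refine (hF.transition_eq (ht.trans htu) (hF.transition_mapsTo ht htu h1) ?_).symm
  rw [hF.apply_transition ht htu h1, hF.apply_transition hs hst hz]

theorem transition_hasFDerivAt (hF : IsLoewnerChain F) (hs : 0 ≤ s) (hst : s ≤ t) :
    HasFDerivAt (transition F s t)
      (((Real.exp (s - t) : ℝ) : ℂ) • ContinuousLinearMap.id ℂ (Cn n)) 0 := by
  have ht := hs.trans hst
  have h0 := unitBall_mem_nhds (zero_mem_unitBall n)
  have hd := ((hF.transition_differentiableOn hs hst).differentiableAt h0).hasFDerivAt
  have h1 : HasFDerivAt (F t) (((Real.exp t : ℝ) : ℂ) • ContinuousLinearMap.id ℂ (Cn n))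
      (transition F s t 0) := by
    rw [hF.transition_zero hs hst]; exact hF.hasFDerivAt t ht
  have h2 := h1.comp (0 : Cn n) hd
  have h3 : HasFDerivAt (F t ∘ transition F s t)
      (((Real.exp s : ℝ) : ℂ) • ContinuousLinearMap.id ℂ (Cn n)) 0 :=
    (hF.hasFDerivAt s hs).congr_of_eventuallyEq <| by
      filter_upwards [h0] with z hz using hF.apply_transition hs hst hz
  have h4 := h2.unique h3
  convert hd using 1
  have hne : ((Real.exp t : ℝ) : ℂ) ≠ 0 := by exact_mod_cast (Real.exp_pos t).ne'
  ext1 v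
  have h5 := congrArg (fun D => ((Real.exp t : ℝ) : ℂ)⁻¹ • D v) h4
  simp only [ContinuousLinearMap.comp_apply, smul_apply,
    ContinuousLinearMap.id_apply, smul_smul, inv_mul_cancel₀ hne, one_smul] at h5
  rw [h5, smul_apply, ContinuousLinearMap.id_apply, Real.exp_sub]
  congr 1
  push_cast
  field_simp

theorem norm_transition_le (hF : IsLoewnerChain F) (hs : 0 ≤ s) (hst : s ≤ t)
    (hz : z ∈ unitBall n) : ‖transition F s t z‖ ≤ ‖z‖ :=
  Complex.norm_le_norm_of_mapsTo_ball (hF.transition_differentiableOn hs hst)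
    ((hF.transition_mapsTo hs hst).mono_right Metric.ball_subset_closedBall)
    (hF.transition_zero hs hst) (mem_ball_zero_iff.1 hz)

theorem norm_sub_transition_le (hF : IsLoewnerChain F) (hs : 0 ≤ s) (hst : s ≤ t) {r : ℝ}
    (hr : r < 1) (hz : ‖z‖ ≤ r) : ‖z - transition F s t z‖ ≤ (t - s) * (8 / (1 - r) ^ 2) := by
  rcases hst.eq_or_lt with rfl | hlt
  · rw [hF.transition_self hs (by rw [mem_ball_zero_iff]; linarith)]
    simp
  · have h1 : Real.exp (s - t) < 1 := by
      simpa using Real.exp_lt_exp.2 (show s - t < 0 by linarith)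
    refine (norm_sub_selfMap_le (hF.transition_differentiableOn hs hst)
      (hF.transition_mapsTo hs hst) (hF.transition_zero hs hst)
      (hF.transition_hasFDerivAt hs hst) h1 hz hr).trans ?_
    refine mul_le_mul_of_nonneg_right ?_ (by positivity)
    linarith [Real.add_one_le_exp (s - t)]

theorem norm_transition_sub_sub_le (hF : IsLoewnerChain F) (hs : 0 ≤ s) (hst : s ≤ t) {r : ℝ}
    (hr : r < 1) {x y : Cn n} (hx : ‖x‖ ≤ r) (hy : ‖y‖ ≤ r) :
    ‖(transition F s t x - x) - (transition F s t y - y)‖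
      ≤ (t - s) * (128 / (1 - r) ^ 3) * ‖x - y‖ := by
  have hr' : 0 < 1 - r := by linarith
  have h := norm_sub_le_of_norm_le_on_ball (f := fun z => transition F s t z - z) (c := 0)
    (R := (1 + r) / 2) (M := (t - s) * (8 / (1 - (1 + r) / 2) ^ 2)) (r := r) (by linarith)
    (((hF.transition_differentiableOn hs hst).sub differentiableOn_id).mono
      (Metric.ball_subset_ball (by linarith)))
    (fun z hz => by
      rw [norm_sub_rev]
      exact hF.norm_sub_transition_le hs hst (by linarith) (mem_ball_zero_iff.1 hz).le)
    (mem_closedBall_zero_iff.2 hx) (mem_closedBall_zero_iff.2 hy)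
  refine h.trans (le_of_eq ?_)
  congr 1
  rw [show 1 - (1 + r) / 2 = (1 - r) / 2 by ring, show (1 + r) / 2 - r = (1 - r) / 2 by ring]
  field_simp
  ring

theorem norm_transition_sub_transition_le (hF : IsLoewnerChain F) (hs : 0 ≤ s) (hst : s ≤ t) {r : ℝ}
    (hr : r < 1) {x y : Cn n} (hx : ‖x‖ ≤ r) (hy : ‖y‖ ≤ r) :
    ‖transition F s t x - transition F s t y‖ ≤ 2 / (1 - r) * ‖x - y‖ := by
  have h := norm_sub_le_of_norm_le_on_ball (f := transition F s t) (c := 0)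
    (R := 1) (M := 1) (r := r) hr (hF.transition_differentiableOn hs hst)
    (fun z hz => (mem_ball_zero_iff.1 (hF.transition_mapsTo hs hst hz)).le)
    (mem_closedBall_zero_iff.2 hx) (mem_closedBall_zero_iff.2 hy)
  simpa using h

/-- The trajectories `t ↦ F_t⁻¹(F_s(z))` are Lipschitz. -/
theorem norm_transition_sub_transition_time_le (hF : IsLoewnerChain F) (hs : 0 ≤ s) (hst : s ≤ t)
    (htu : t ≤ u) {r : ℝ} (hr : r < 1) (hz : ‖z‖ ≤ r) :
    ‖transition F s t z - transition F s u z‖ ≤ (u - t) * (8 / (1 - r) ^ 2) := by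
  have hzb : z ∈ unitBall n := by rw [mem_ball_zero_iff]; linarith
  rw [← hF.transition_transition hs hst htu hzb]
  exact hF.norm_sub_transition_le (hs.trans hst) htu hr ((hF.norm_transition_le hs hst hzb).trans hz)

end IsLoewnerChain

/-! ### Almost everywhere differentiability of the transition maps -/

/-- An equi-Lipschitz family that converges at the points of a dense set converges everywhere. -/
theorem exists_tendsto_of_dense_of_lipschitz {ι E G : Type*} [SeminormedAddCommGroup E]
    [NormedAddCommGroup G] [CompleteSpace G] {l : Filter ι} [l.NeBot] {q : ι → E → G} {S D : Set E}
    {K : ℝ} (hK : ∀ᶠ i in l, ∀ x ∈ S, ∀ y ∈ S, ‖q i x - q i y‖ ≤ K * ‖x - y‖)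
    (hD : ∀ x ∈ D, ∃ v, Tendsto (fun i => q i x) l (𝓝 v)) {z : E} (hz : z ∈ S)
    (hzD : z ∈ closure (D ∩ S)) : ∃ v, Tendsto (fun i => q i z) l (𝓝 v) := by
  rw [← cauchy_map_iff_exists_tendsto, Metric.cauchy_iff]
  refine ⟨inferInstance, fun ε hε => ?_⟩
  obtain ⟨y, ⟨hyD, hyS⟩, hy⟩ := Metric.mem_closure_iff.1 hzD (ε / (4 * (|K| + 1))) (by positivity)
  obtain ⟨v, hv⟩ := hD y hyD
  have hclose : K * ‖z - y‖ ≤ ε / 4 := by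
    rw [dist_eq_norm] at hy
    calc K * ‖z - y‖ ≤ (|K| + 1) * (ε / (4 * (|K| + 1))) := by
          gcongr
          linarith [le_abs_self K]
      _ = ε / 4 := by field_simp
  refine ⟨Metric.ball v (ε / 2), ?_, fun a ha b hb => ?_⟩
  · rw [mem_map]
    filter_upwards [hK, hv (Metric.ball_mem_nhds v (show 0 < ε / 4 by positivity))] with i hi hvi
    rw [mem_preimage, mem_ball_iff_norm] at hvi ⊢
    have h1 := hi z hz y hyS
    have h2 := norm_sub_le_norm_sub_add_norm_sub (q i z) (q i y) v
    linarith
  · linarith [dist_triangle_right a b v, Metric.mem_ball.1 ha, Metric.mem_ball.1 hb]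

theorem exists_hol_eqOn {n : ℕ} {f : Cn n → Cn n} (hf : DifferentiableOn ℂ f (unitBall n)) :
    ∃ g : Hol n, EqOn g f (unitBall n) := by
  let g : C(unitBall n, Cn n) := ⟨fun z => f z, continuousOn_iff_continuous_domRestrict.1 hf.continuousOn⟩
  have h : EqOn (zeroExt g) f (unitBall n) := zeroExt_eqOn fun _ => rfl
  exact ⟨⟨g, hf.congr h⟩, h⟩

theorem Hol.differentiableOn {n : ℕ} (f : Hol n) : DifferentiableOn ℂ f (unitBall n) := f.2

namespace IsLoewnerChain

variable {n : ℕ} {F : ℝ → Cn n → Cn n} {s t u : ℝ} {z : Cn n} {D : Set (Cn n)}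

/-- Times at which all trajectories that start at a rational time in a given set of points
are differentiable. -/
def IsRegularTime (F : ℝ → Cn n → Cn n) (D : Set (Cn n)) (t : ℝ) : Prop :=
  0 < t ∧ ∀ s : ℚ, (0 : ℝ) ≤ s → (s : ℝ) < t → ∀ z ∈ D ∩ unitBall n,
    DifferentiableAt ℝ (fun τ => transition F s τ z) t

theorem lipschitzOnWith_transition (hF : IsLoewnerChain F) (hs : 0 ≤ s) (hz : z ∈ unitBall n) :
    ∃ C, LipschitzOnWith C (fun t => transition F s t z) (Ici s) := by
  have hz1 := mem_ball_zero_iff.1 hz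
  have hC : 0 ≤ 8 / (1 - ‖z‖) ^ 2 := by positivity
  refine ⟨(8 / (1 - ‖z‖) ^ 2).toNNReal, LipschitzOnWith.of_dist_le_mul fun t ht u hu => ?_⟩
  rw [Real.coe_toNNReal _ hC, dist_eq_norm, Real.dist_eq]
  rcases le_total t u with h | h
  · rw [abs_sub_comm, abs_of_nonneg (by linarith), mul_comm]
    exact hF.norm_transition_sub_transition_time_le hs ht h hz1 le_rfl
  · rw [norm_sub_rev, abs_of_nonneg (by linarith), mul_comm]
    exact hF.norm_transition_sub_transition_time_le hs hu h hz1 le_rfl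

theorem ae_isRegularTime (hF : IsLoewnerChain F) (hD : D.Countable) :
    ∀ᵐ t ∂(volume.restrict (Ici (0 : ℝ))), IsRegularTime F D t := by
  rw [ae_restrict_iff' measurableSet_Ici]
  have h0 : ∀ᵐ t : ℝ, t ≠ 0 := Measure.ae_ne volume 0
  have h1 : ∀ᵐ t : ℝ, ∀ s : ℚ, (0 : ℝ) ≤ s → (s : ℝ) < t → ∀ z ∈ D ∩ unitBall n,
      DifferentiableAt ℝ (fun τ => transition F s τ z) t := by
    refine ae_all_iff.2 fun s => ?_
    by_cases hs : (0 : ℝ) ≤ s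
    · have h2 : ∀ᵐ t : ℝ, ∀ z ∈ D ∩ unitBall n, t ∈ Ici (s : ℝ) →
          DifferentiableWithinAt ℝ (fun τ => transition F s τ z) (Ici s) t := by
        refine (ae_ball_iff (hD.mono inter_subset_left)).2 fun z hz => ?_
        obtain ⟨C, hC⟩ := hF.lipschitzOnWith_transition hs hz.2
        exact hC.ae_differentiableWithinAt_of_mem
      filter_upwards [h2] with t ht _ hst z hz
      exact (ht z hz hst.le).differentiableAt (Ici_mem_nhds hst)
    · exact Eventually.of_forall fun t h => absurd h hs
  filter_upwards [h0, h1] with t ht0 ht1 ht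
  exact ⟨lt_of_le_of_ne ht (Ne.symm ht0), ht1⟩

theorem mem_closure_inter_ball (hD : Dense D) {r : ℝ} (hz : ‖z‖ < r) :
    z ∈ closure (D ∩ Metric.ball 0 r) := by
  rw [inter_comm]
  exact hD.open_subset_closure_inter Metric.isOpen_ball (mem_ball_zero_iff.2 hz)

/-- At a regular time the right difference quotients converge at all points `F_t⁻¹(F_s(w))` with `s`
rational and `w` in the dense set; these are dense in the ball, because they tend to `w` as `s ↑ t`. -/
theorem exists_tendsto_quotient (hF : IsLoewnerChain F) (hD : Dense D) (ht : IsRegularTime F D t)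
    (hz : z ∈ unitBall n) :
    ∃ v, Tendsto (fun h : ℝ => h⁻¹ • (transition F t (t + h) z - z)) (𝓝[>] 0) (𝓝 v) := by
  have ht0 := ht.1.le
  obtain ⟨r, hzr, hr⟩ := exists_between (mem_ball_zero_iff.1 hz)
  refine exists_tendsto_of_dense_of_lipschitz (S := Metric.ball 0 r)
    (D := {p | ∃ s : ℚ, (0 : ℝ) ≤ s ∧ (s : ℝ) < t ∧ ∃ w ∈ D ∩ unitBall n, transition F s t w = p})
    (q := fun h z => h⁻¹ • (transition F t (t + h) z - z)) (l := 𝓝[>] (0 : ℝ))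
    (K := 128 / (1 - r) ^ 3) ?_ ?_ (mem_ball_zero_iff.2 hzr) ?_
  · filter_upwards [self_mem_nhdsWithin] with h (hh : 0 < h) x hx y hy
    have := hF.norm_transition_sub_sub_le ht0 (show t ≤ t + h by linarith) hr
      (mem_ball_zero_iff.1 hx).le (mem_ball_zero_iff.1 hy).le
    rw [← smul_sub, norm_smul, norm_inv, Real.norm_of_nonneg hh.le, inv_mul_le_iff₀ hh]
    refine this.trans (le_of_eq ?_)
    ring
  · rintro _ ⟨s, hs, hst, w, hw, rfl⟩
    have hd := (ht.2 s hs hst w hw).hasDerivAt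
    refine ⟨_, (hd.tendsto_slope_zero_right).congr' ?_⟩
    filter_upwards [self_mem_nhdsWithin] with h (hh : 0 < h)
    rw [hF.transition_transition hs hst.le (by linarith) hw.2]
  · rw [Metric.mem_closure_iff]
    intro ε hε
    obtain ⟨w, ⟨hwD, hwr⟩, hw⟩ := Metric.mem_closure_iff.1 (mem_closure_inter_ball hD hzr) (ε / 2)
      (by positivity)
    rw [mem_ball_zero_iff] at hwr
    have hr' : 0 < 1 - r := by linarith
    have hC : 0 < 8 / (1 - r) ^ 2 := by positivity
    obtain ⟨s, hs1, hs2⟩ := exists_rat_btwn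
      (show max 0 (t - ε / (2 * (8 / (1 - r) ^ 2))) < t from
        max_lt ht.1 (by linarith [show 0 < ε / (2 * (8 / (1 - r) ^ 2)) by positivity]))
    have hs0 : (0 : ℝ) ≤ s := (le_max_left _ _).trans hs1.le
    have hwb : w ∈ unitBall n := mem_ball_zero_iff.2 (hwr.trans hr)
    refine ⟨transition F s t w, ⟨⟨s, hs0, hs2, w, ⟨hwD, hwb⟩, rfl⟩, ?_⟩, ?_⟩
    · exact mem_ball_zero_iff.2 ((hF.norm_transition_le hs0 hs2.le hwb).trans_lt hwr)
    · have h1 := hF.norm_sub_transition_le hs0 hs2.le hr hwr.le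
      have h2 : (t - s) * (8 / (1 - r) ^ 2) ≤ ε / 2 := by
        have h3 : t - s ≤ ε / (2 * (8 / (1 - r) ^ 2)) := by linarith [(le_max_right _ _).trans hs1.le]
        calc _ ≤ ε / (2 * (8 / (1 - r) ^ 2)) * (8 / (1 - r) ^ 2) := by gcongr
          _ = ε / 2 := by rw [div_mul_eq_mul_div, mul_div_mul_right _ _ hC.ne']
      rw [← dist_eq_norm] at h1
      linarith [dist_triangle z w (transition F s t w)]

theorem exists_hasDerivAt_transition (hF : IsLoewnerChain F) (hD : Dense D)
    (ht : IsRegularTime F D t) (hz : z ∈ unitBall n) :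
    ∃ v, HasDerivAt (fun τ => transition F 0 τ z) v t := by
  have ht0 := ht.1.le
  obtain ⟨r, hzr, hr⟩ := exists_between (mem_ball_zero_iff.1 hz)
  have hr0 : 0 < r := (norm_nonneg z).trans_lt hzr
  simp_rw [hasDerivAt_iff_tendsto_slope]
  refine exists_tendsto_of_dense_of_lipschitz (S := Metric.ball 0 r) (D := D ∩ unitBall n)
    (K := 128 / (1 - r) ^ 3 * (2 / (1 - r))) (q := fun τ z => slope (fun τ => transition F 0 τ z) t τ)
    ?_ ?_ (mem_ball_zero_iff.2 hzr) ?_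
  · have key : ∀ a b, 0 ≤ a → a ≤ b → ∀ x ∈ Metric.ball (0 : Cn n) r, ∀ y ∈ Metric.ball (0 : Cn n) r,
        ‖(transition F 0 b x - transition F 0 a x) - (transition F 0 b y - transition F 0 a y)‖
          ≤ (b - a) * (128 / (1 - r) ^ 3 * (2 / (1 - r)) * ‖x - y‖) := by
      intro a b ha hab x hx y hy
      rw [mem_ball_zero_iff] at hx hy
      have hxb : x ∈ unitBall n := mem_ball_zero_iff.2 (hx.trans hr)
      have hyb : y ∈ unitBall n := mem_ball_zero_iff.2 (hy.trans hr)
      rw [← hF.transition_transition le_rfl ha hab hxb, ← hF.transition_transition le_rfl ha hab hyb]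
      have hr' : 0 < 1 - r := by linarith
      calc _ ≤ (b - a) * (128 / (1 - r) ^ 3) * ‖transition F 0 a x - transition F 0 a y‖ :=
            hF.norm_transition_sub_sub_le ha hab hr
              ((hF.norm_transition_le le_rfl ha hxb).trans hx.le)
              ((hF.norm_transition_le le_rfl ha hyb).trans hy.le)
        _ ≤ (b - a) * (128 / (1 - r) ^ 3) * (2 / (1 - r) * ‖x - y‖) := by
            refine mul_le_mul_of_nonneg_left ?_ (mul_nonneg (by linarith) (by positivity))
            exact hF.norm_transition_sub_transition_le le_rfl ha hr hx.le hy.le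
        _ = _ := by ring
    filter_upwards [self_mem_nhdsWithin, mem_nhdsWithin_of_mem_nhds (Ioi_mem_nhds ht.1)]
      with τ (hτt : τ ≠ t) (hτ : 0 < τ) x hx y hy
    have hpos : 0 < |τ - t| := abs_pos.2 (sub_ne_zero.2 hτt)
    rw [slope_def_module, slope_def_module, ← smul_sub, norm_smul, norm_inv, Real.norm_eq_abs,
      inv_mul_le_iff₀ hpos]
    rcases le_total t τ with h | h
    · rw [abs_of_nonneg (by linarith)]
      exact key t τ ht0 h x hx y hy
    · rw [abs_of_nonpos (by linarith), neg_sub, ← norm_neg]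
      refine (le_of_eq ?_).trans (key τ t hτ.le h x hx y hy)
      congr 1
      beta_reduce
      abel
  · intro w hw
    have hd := (ht.2 0 (by simp) (by simpa using ht.1) w hw).hasDerivAt
    rw [Rat.cast_zero] at hd
    exact ⟨_, hasDerivAt_iff_tendsto_slope.1 hd⟩
  · rw [inter_assoc, inter_eq_right.2 (Metric.ball_subset_ball hr.le)]
    exact mem_closure_inter_ball hD hzr

/-- The infinitesimal generator of the transition maps. -/
noncomputable def generator (F : ℝ → Cn n → Cn n) (z : Cn n) (t : ℝ) : Cn n :=
  limUnder (𝓝[>] (0 : ℝ)) fun h : ℝ => h⁻¹ • (transition F t (t + h) z - z)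

theorem tendsto_generator (hF : IsLoewnerChain F) (hD : Dense D) (ht : IsRegularTime F D t)
    (hz : z ∈ unitBall n) :
    Tendsto (fun h : ℝ => h⁻¹ • (transition F t (t + h) z - z)) (𝓝[>] 0) (𝓝 (generator F z t)) :=
  tendsto_nhds_limUnder (hF.exists_tendsto_quotient hD ht hz)

theorem hasDerivAt_transition (hF : IsLoewnerChain F) (hD : Dense D) (ht : IsRegularTime F D t)
    (hz : z ∈ unitBall n) :
    HasDerivAt (fun τ => transition F 0 τ z) (generator F (transition F 0 t z) t) t := by
  obtain ⟨v, hv⟩ := hF.exists_hasDerivAt_transition hD ht hz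
  have h1 := hF.tendsto_generator hD ht (hF.transition_mapsTo le_rfl ht.1.le hz)
  have h2 : Tendsto (fun h : ℝ => h⁻¹ • (transition F t (t + h) (transition F 0 t z) -
      transition F 0 t z)) (𝓝[>] 0) (𝓝 v) := by
    refine hv.tendsto_slope_zero_right.congr' ?_
    filter_upwards [self_mem_nhdsWithin] with h (hh : 0 < h)
    rw [hF.transition_transition le_rfl ht.1.le (by linarith) hz]
  rwa [tendsto_nhds_unique h1 h2]

theorem tendsto_seq_generator (hF : IsLoewnerChain F) (hD : Dense D) (ht : IsRegularTime F D t)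
    (hz : z ∈ unitBall n) :
    Tendsto (fun k : ℕ => (1 / ((k : ℝ) + 1))⁻¹ • (transition F t (t + 1 / ((k : ℝ) + 1)) z - z))
      atTop (𝓝 (generator F z t)) := by
  refine (hF.tendsto_generator hD ht hz).comp (tendsto_nhdsWithin_iff.2
    ⟨tendsto_one_div_add_atTop_nhds_zero_nat, Eventually.of_forall fun k => ?_⟩)
  exact mem_Ioi.2 (by positivity)

end IsLoewnerChain

/-! ### The Herglotz vector field of a Loewner chain -/

namespace IsLoewnerChain

variable {n : ℕ} {F : ℝ → Cn n → Cn n} {s t u : ℝ} {z : Cn n} {D : Set (Cn n)}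

theorem continuousOn_transition_shift (hF : IsLoewnerChain F) {h : ℝ} (hh : 0 ≤ h)
    (hz : z ∈ unitBall n) : ContinuousOn (fun t => transition F t (t + h) z) (Ici 0) := by
  have hz1 := mem_ball_zero_iff.1 hz
  have hz' : 0 < 1 - ‖z‖ := by linarith
  have key : ∀ a b, 0 ≤ a → a ≤ b → ‖transition F a (a + h) z - transition F b (b + h) z‖
      ≤ (8 / (1 - ‖z‖) ^ 2 + 2 / (1 - ‖z‖) * (8 / (1 - ‖z‖) ^ 2)) * (b - a) := by
    intro a b ha hab
    have h1 := hF.norm_transition_sub_transition_time_le ha (show a ≤ a + h by linarith)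
      (show a + h ≤ b + h by linarith) hz1 le_rfl
    have h2 := hF.norm_transition_sub_transition_le (ha.trans hab) (show b ≤ b + h by linarith) hz1
      (hF.norm_transition_le ha hab hz) le_rfl
    rw [hF.transition_transition ha hab (by linarith) hz] at h2
    have h3 := hF.norm_sub_transition_le ha hab hz1 le_rfl
    rw [norm_sub_rev] at h3
    have h4 := norm_sub_le_norm_sub_add_norm_sub (transition F a (a + h) z)
      (transition F a (b + h) z) (transition F b (b + h) z)
    have h5 := mul_le_mul_of_nonneg_left h3 (show 0 ≤ 2 / (1 - ‖z‖) by positivity)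
    linarith
  have hC : 0 ≤ 8 / (1 - ‖z‖) ^ 2 + 2 / (1 - ‖z‖) * (8 / (1 - ‖z‖) ^ 2) := by positivity
  refine (LipschitzOnWith.of_dist_le_mul (K := (8 / (1 - ‖z‖) ^ 2 + 2 / (1 - ‖z‖) *
    (8 / (1 - ‖z‖) ^ 2)).toNNReal) fun a ha b hb => ?_).continuousOn
  rw [Real.coe_toNNReal _ hC, dist_eq_norm, Real.dist_eq]
  rcases le_total a b with h | h
  · rw [abs_sub_comm, abs_of_nonneg (by linarith)]
    exact key a b ha h
  · rw [norm_sub_rev, abs_of_nonneg (by linarith)]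
    exact key b a hb h

theorem tendsto_one_sub_exp_div :
    Tendsto (fun k : ℕ => (1 / ((k : ℝ) + 1))⁻¹ * (1 - Real.exp (-(1 / ((k : ℝ) + 1))))) atTop
      (𝓝 1) := by
  have h1 : HasDerivAt (fun x : ℝ => -Real.exp (-x)) 1 0 := by
    have := ((hasDerivAt_neg' (0 : ℝ)).exp).fun_neg
    simpa using this
  refine ((h1.tendsto_slope_zero_right).comp (tendsto_nhdsWithin_iff.2
    ⟨tendsto_one_div_add_atTop_nhds_zero_nat, Eventually.of_forall fun k => ?_⟩)).congr fun k => ?_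
  · exact mem_Ioi.2 (by positivity)
  · simp only [Function.comp_apply, zero_add, neg_zero, Real.exp_zero, smul_eq_mul]
    ring

/-- The generator at a regular time is the limit of the difference quotients of self-maps of the ball,
and inherits from them holomorphy, normalization and the lower bound for `Re ⟨z, h z⟩`. -/
theorem exists_mem_classM_generator (hF : IsLoewnerChain F) (hD : Dense D)
    (ht : IsRegularTime F D t) : ∃ h ∈ classM n, ∀ z ∈ unitBall n, -generator F z t = h z := by
  have ht0 := ht.1.le
  set η : ℕ → ℝ := fun k => 1 / ((k : ℝ) + 1) with hη
  have hη0 : ∀ k, 0 < η k := fun k => by positivity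
  have hle : ∀ k, t ≤ t + η k := fun k => by linarith [hη0 k]
  set q : ℕ → Cn n → Cn n := fun k z => ((η k)⁻¹ : ℂ) • (z - transition F t (t + η k) z) with hq
  have hqr : ∀ k z, q k z = (η k)⁻¹ • (z - transition F t (t + η k) z) := by
    intro k z
    simp only [hq]
    rw [← Complex.ofReal_inv, Complex.coe_smul]
  have hqd : ∀ k, DifferentiableOn ℂ (q k) (unitBall n) := fun k =>
    (differentiableOn_id.sub (hF.transition_differentiableOn ht0 (hle k))).const_smul
      ((η k)⁻¹ : ℂ)
  have hqM : ∀ k r, r < 1 → ∀ z, ‖z‖ ≤ r → ‖q k z‖ ≤ 8 / (1 - r) ^ 2 := by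
    intro k r hr z hz
    rw [hqr, norm_smul, norm_inv, Real.norm_of_nonneg (hη0 k).le, inv_mul_le_iff₀ (hη0 k)]
    simpa using hF.norm_sub_transition_le ht0 (hle k) hr hz
  have hqlim : ∀ z ∈ unitBall n, Tendsto (fun k => q k z) atTop (𝓝 (-generator F z t)) := by
    intro z hz
    refine (hF.tendsto_seq_generator hD ht hz).neg.congr fun k => ?_
    rw [hqr, ← smul_neg, neg_sub]
  have hloc : ∀ z ∈ unitBall n, ∃ (D : Cn n →L[ℂ] Cn n) (σ : ℕ → ℕ), StrictMono σ ∧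
      HasFDerivAt (fun z => -generator F z t) D z ∧
        Tendsto (fun k => fderiv ℂ (q (σ k)) z) atTop (𝓝 D) := by
    intro z hz
    have hz1 := mem_ball_zero_iff.1 hz
    have hsub : ∀ x ∈ Metric.ball z ((1 - ‖z‖) / 2), ‖x‖ ≤ (1 + ‖z‖) / 2 := by
      intro x hx
      rw [mem_ball_iff_norm] at hx
      linarith [norm_le_norm_sub_add x z]
    have hsubB : Metric.ball z ((1 - ‖z‖) / 2) ⊆ unitBall n := fun x hx => by
      rw [mem_ball_zero_iff]; linarith [hsub x hx]
    exact exists_hasFDerivAt_of_tendsto_of_norm_le (by linarith) (fun k => (hqd k).mono hsubB)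
      (fun k x hx => hqM k _ (by linarith) x (hsub x hx)) fun x hx => hqlim x (hsubB hx)
  have hdiff : DifferentiableOn ℂ (fun z => -generator F z t) (unitBall n) := fun z hz => by
    obtain ⟨D, -, -, hD, -⟩ := hloc z hz
    exact hD.differentiableAt.differentiableWithinAt
  have h0B := zero_mem_unitBall n
  obtain ⟨g, hg⟩ := exists_hol_eqOn hdiff
  refine ⟨g, ⟨?_, ?_, ?_⟩, fun z hz => (hg hz).symm⟩
  · rw [hg h0B]
    refine tendsto_nhds_unique (hqlim 0 h0B) ?_
    refine tendsto_const_nhds.congr fun k => ?_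
    simp [hq, hF.transition_zero ht0 (hle k)]
  · obtain ⟨D, σ, hσ, hDf, hDlim⟩ := hloc 0 h0B
    have hDid : D = ContinuousLinearMap.id ℂ (Cn n) := by
      refine tendsto_nhds_unique hDlim ?_
      have h1 : ∀ k, fderiv ℂ (q k) 0 = (((η k)⁻¹ * (1 - Real.exp (-η k)) : ℝ) : ℂ) •
          ContinuousLinearMap.id ℂ (Cn n) := by
        intro k
        have h2 := ((hasFDerivAt_id (𝕜 := ℂ) (0 : Cn n)).sub
          (hF.transition_hasFDerivAt ht0 (hle k))).const_smul ((η k)⁻¹ : ℂ)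
        refine (HasFDerivAt.fderiv (f := q k) h2).trans ?_
        ext1 v
        simp only [smul_apply, sub_apply, ContinuousLinearMap.id_apply]
        rw [← one_smul ℂ v]
        simp only [smul_smul, ← sub_smul, mul_one]
        rw [show t - (t + η k) = -η k by ring]
        push_cast
        rfl
      have h3 := (Complex.continuous_ofReal.tendsto 1).comp tendsto_one_sub_exp_div
      have h4 := (h3.comp hσ.tendsto_atTop).smul_const (ContinuousLinearMap.id ℂ (Cn n))
      rw [Complex.ofReal_one, one_smul] at h4
      refine h4.congr fun k => ?_
      rw [h1]
      rfl
    rw [← hDid]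
    exact hDf.congr_of_eventuallyEq (hg.eventuallyEq_of_mem (unitBall_mem_nhds h0B))
  · intro z hz hz0
    rw [hg hz]
    have hz1 := mem_ball_zero_iff.1 hz
    have hzpos : 0 < ‖z‖ := norm_pos_iff.2 hz0
    have hpos : 0 < ‖z‖ ^ 2 * ((1 - ‖z‖) / (1 + ‖z‖)) := by
      have : 0 < 1 - ‖z‖ := by linarith
      positivity
    refine hpos.trans_le ?_
    rw [← inner_conj_symm, Complex.conj_re]
    have h1 : Tendsto (fun k => (inner ℂ z (q k z)).re) atTop
        (𝓝 (inner ℂ z (-generator F z t)).re) :=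
      ((Complex.continuous_re.comp (innerSL ℂ z).continuous).tendsto _).comp (hqlim z hz)
    have h2 := tendsto_one_sub_exp_div.mul_const (‖z‖ ^ 2 * ((1 - ‖z‖) / (1 + ‖z‖)))
    rw [one_mul] at h2
    refine le_of_tendsto_of_tendsto' h2 h1 fun k => ?_
    have h3 := (inner_sub_selfMap_bounds (hF.transition_differentiableOn ht0 (hle k))
      (hF.transition_mapsTo ht0 (hle k)) (hF.transition_zero ht0 (hle k))
      (hF.transition_hasFDerivAt ht0 (hle k)) (by
        simpa using Real.exp_lt_exp.2 (show t - (t + η k) < 0 by linarith [hη0 k])) hz1).1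
    simp only [hq]
    rw [inner_smul_right, ← Complex.ofReal_inv, Complex.re_ofReal_mul, mul_assoc]
    refine mul_le_mul_of_nonneg_left ?_ (inv_nonneg.2 (hη0 k).le)
    rwa [show t - (t + η k) = -η k by ring] at h3

/-- The transition maps of a Loewner chain are driven by a Herglotz vector field. -/
theorem exists_isHerglotz_solvesLoewnerODE (hF : IsLoewnerChain F) :
    ∃ G : Cn n → ℝ → Cn n, IsHerglotz G ∧ SolvesLoewnerODE G fun z t => transition F 0 t z := by
  obtain ⟨D, hDc, hD⟩ := TopologicalSpace.exists_countable_dense (Cn n)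
  have hae := hF.ae_isRegularTime hDc
  refine ⟨generator F, ⟨fun z hz => ?_, ?_⟩, fun z hz => hF.transition_self le_rfl hz,
    fun z hz t ht => hF.transition_mapsTo le_rfl ht hz, fun z hz T hT => ?_, ?_⟩
  · refine aemeasurable_of_tendsto_metrizable_ae atTop (fun k : ℕ => ?_)
      (hae.mono fun t ht => hF.tendsto_seq_generator hD ht hz)
    have := (hF.continuousOn_transition_shift (show 0 ≤ 1 / ((k : ℝ) + 1) by positivity)
      hz).aemeasurable measurableSet_Ici (μ := volume)
    exact (this.sub_const z).const_smul (1 / ((k : ℝ) + 1))⁻¹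
  · exact hae.mono fun t ht => hF.exists_mem_classM_generator hD ht
  · obtain ⟨C, hC⟩ := hF.lipschitzOnWith_transition le_rfl hz
    refine (hC.mono ?_).absolutelyContinuousOnInterval
    rw [uIcc_of_le hT]
    exact Icc_subset_Ici_self
  · exact hae.mono fun t ht z hz => hF.hasDerivAt_transition hD ht hz

end IsLoewnerChain

/-! ### Parametric representation and injectivity of the differentials -/

theorem injective_of_norm_sub_smul_id_le {E : Type*} [NormedAddCommGroup E] [NormedSpace ℂ E]
    {A : E →L[ℂ] E} {c : ℂ} (hc : c ≠ 0) (h : ‖A - c • ContinuousLinearMap.id ℂ E‖ ≤ ‖c‖ / 2) :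
    Function.Injective A := by
  refine (injective_iff_map_eq_zero A).2 fun v hv => ?_
  have h1 := (A - c • ContinuousLinearMap.id ℂ E).le_of_opNorm_le h v
  rw [sub_apply, hv, zero_sub, norm_neg, smul_apply, ContinuousLinearMap.id_apply, norm_smul] at h1
  have hc' := norm_pos_iff.2 hc
  by_contra hv0
  have := mul_pos hc' (norm_pos_iff.2 hv0)
  linarith

/-- Boundedness of the family `e^{-t} F_t`, for large `t`, near the origin. -/
def IsTailBounded {n : ℕ} (F : ℝ → Cn n → Cn n) : Prop :=
  ∃ U M : ℝ, 0 ≤ U ∧ 0 ≤ M ∧ ∀ t, U ≤ t → ∀ z ∈ Metric.ball (0 : Cn n) (1 / 2),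
    ‖F t z‖ ≤ Real.exp t * M

namespace IsLoewnerChain

variable {n : ℕ} {F : ℝ → Cn n → Cn n} {s t u : ℝ} {z : Cn n} {D : Set (Cn n)}

theorem ofReal_smul_id_apply (a : ℝ) (v : Cn n) :
    (((a : ℝ) : ℂ) • ContinuousLinearMap.id ℂ (Cn n)) v = a • v := by
  rw [smul_apply, ContinuousLinearMap.id_apply, Complex.coe_smul]

theorem norm_sub_exp_smul_le (hF : IsLoewnerChain F) (ht : 0 ≤ t) {M : ℝ}
    (hM : ∀ z ∈ Metric.ball (0 : Cn n) (1 / 2), ‖F t z‖ ≤ Real.exp t * M) {w : Cn n}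
    (hw : ‖w‖ < 1 / 2) : ‖F t w - Real.exp t • w‖ ≤ 16 * M * Real.exp t * ‖w‖ ^ 2 := by
  have h := norm_remainder_le_of_norm_le_on_ball
    ((hF.differentiableOn t ht).mono (Metric.ball_subset_ball (by norm_num))) hM
    (hF.hasFDerivAt t ht) (mem_ball_zero_iff.2 hw)
  rw [hF.map_zero t ht, sub_zero, sub_zero, ofReal_smul_id_apply] at h
  refine h.trans (le_of_eq ?_)
  ring

/-- Over a time step of fixed length the transition maps are strict contractions towards the
origin, uniformly on smaller balls. -/
theorem exists_norm_transition_step_le (hF : IsLoewnerChain F) {r : ℝ} (hr0 : 0 ≤ r) (hr : r < 1) :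
    ∃ h > 0, ∃ q, 0 ≤ q ∧ q < 1 ∧ ∀ s, 0 ≤ s → ∀ z : Cn n, ‖z‖ ≤ r →
      ‖transition F s (s + h) z‖ ≤ q * ‖z‖ := by
  have hr' : 0 < 1 - r := by linarith
  set K := 128 / (1 - r) ^ 3 with hK
  set κ := (1 - r) / (1 + r) with hκ
  have hK0 : 0 < K := by positivity
  have hκ0 : 0 < κ := by positivity
  have hκ1 : κ ≤ 1 := by rw [hκ, div_le_one (by linarith)]; linarith
  obtain ⟨h, hh0, hh1, hhK⟩ : ∃ h : ℝ, 0 < h ∧ h ≤ 1 ∧ h * K ^ 2 ≤ κ / 2 := by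
    refine ⟨min 1 (κ / (2 * K ^ 2)), by positivity, min_le_left _ _, ?_⟩
    calc _ ≤ κ / (2 * K ^ 2) * K ^ 2 := by gcongr; exact min_le_right _ _
      _ = κ / 2 := by clear_value K κ; field_simp
  refine ⟨h, hh0, √(1 - h * κ / 2), Real.sqrt_nonneg _, ?_, fun s hs z hz => ?_⟩
  · rw [Real.sqrt_lt' one_pos]
    have := mul_pos hh0 hκ0
    linarith
  have hsh : s ≤ s + h := by linarith
  have hz1 : ‖z‖ < 1 := hz.trans_lt hr
  have h1 := (inner_sub_selfMap_bounds (hF.transition_differentiableOn hs hsh)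
      (hF.transition_mapsTo hs hsh) (hF.transition_zero hs hsh)
      (hF.transition_hasFDerivAt hs hsh) (by
        simpa using Real.exp_lt_exp.2 (show s - (s + h) < 0 by linarith)) hz1).1
  have h2 := hF.norm_transition_sub_sub_le hs hsh hr hz (y := 0) (by simpa using hr0)
  rw [hF.transition_zero hs hsh, sub_self, sub_zero, sub_zero, add_sub_cancel_left,
    norm_sub_rev] at h2
  rw [show s - (s + h) = -h by ring] at h1
  set x := z - transition F s (s + h) z with hx
  have h3 : transition F s (s + h) z = z - x := by rw [hx]; abel
  have h4 : h / 2 ≤ 1 - Real.exp (-h) := by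
    have : Real.exp (-h) ≤ 1 / (1 + h) := by
      rw [Real.exp_neg, ← one_div]
      exact one_div_le_one_div_of_le (by linarith) (by linarith [Real.add_one_le_exp h])
    have h5 : 1 / (1 + h) ≤ 1 - h / 2 := by
      rw [div_le_iff₀ (by linarith)]
      nlinarith
    linarith
  have h5 : κ ≤ (1 - ‖z‖) / (1 + ‖z‖) := by
    rw [hκ]
    gcongr
  have h6 : h / 2 * (‖z‖ ^ 2 * κ) ≤ (inner ℂ z x).re :=
    (mul_le_mul h4 (mul_le_mul_of_nonneg_left h5 (sq_nonneg _)) (by positivity)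
      (by linarith)).trans h1
  have h7 : ‖z - x‖ ^ 2 = ‖z‖ ^ 2 - 2 * (inner ℂ z x).re + ‖x‖ ^ 2 := by
    simpa using norm_sub_sq (𝕜 := ℂ) z x
  have h8 : ‖x‖ ^ 2 ≤ (h * K * ‖z‖) ^ 2 := pow_le_pow_left₀ (norm_nonneg _) h2 2
  have h9 : (h * K * ‖z‖) ^ 2 ≤ h * (κ / 2) * ‖z‖ ^ 2 := by
    have : h * (h * K ^ 2) ≤ h * (κ / 2) := mul_le_mul_of_nonneg_left hhK hh0.le
    calc _ = h * (h * K ^ 2) * ‖z‖ ^ 2 := by ring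
      _ ≤ _ := by gcongr
  have h10 : 0 ≤ 1 - h * κ / 2 := by nlinarith
  rw [h3]
  refine abs_le_of_sq_le_sq' ?_ (by positivity) |>.2
  rw [mul_pow, Real.sq_sqrt h10, h7]
  nlinarith

theorem exists_norm_transition_le (hF : IsLoewnerChain F) {r δ : ℝ} (hr : r < 1) (hδ : 0 < δ) :
    ∃ T, 0 ≤ T ∧ ∀ s t, 0 ≤ s → s + T ≤ t → ∀ z : Cn n, ‖z‖ ≤ r → ‖transition F s t z‖ ≤ δ := by
  rcases lt_or_ge r 0 with hr0 | hr0
  · exact ⟨0, le_rfl, fun s t _ _ z hz => absurd (norm_nonneg z) (by linarith)⟩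
  obtain ⟨h, hh, q, hq0, hq1, hstep⟩ := hF.exists_norm_transition_step_le hr0 hr
  have hiter : ∀ N : ℕ, ∀ s, 0 ≤ s → ∀ z : Cn n, ‖z‖ ≤ r →
      ‖transition F s (s + N * h) z‖ ≤ q ^ N := by
    intro N
    induction N with
    | zero =>
      intro s hs z hz
      have hzb : z ∈ unitBall n := mem_ball_zero_iff.2 (hz.trans_lt hr)
      rw [Nat.cast_zero, zero_mul, add_zero, hF.transition_self hs hzb, pow_zero]
      linarith
    | succ N ih =>
      intro s hs z hz
      have hzb : z ∈ unitBall n := mem_ball_zero_iff.2 (hz.trans_lt hr)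
      have hNh : 0 ≤ N * h := by positivity
      have h1 := hstep (s + N * h) (by linarith) (transition F s (s + N * h) z)
        ((hF.norm_transition_le hs (by linarith) hzb).trans hz)
      rw [hF.transition_transition hs (by linarith) (by linarith) hzb] at h1
      rw [Nat.cast_succ, show s + (N + 1) * h = s + N * h + h by ring, pow_succ,
        mul_comm (q ^ N)]
      exact h1.trans (mul_le_mul_of_nonneg_left (ih s hs z hz) hq0)
  obtain ⟨N, hN⟩ := exists_pow_lt_of_lt_one hδ hq1
  refine ⟨N * h, by positivity, fun s t hs ht z hz => ?_⟩
  have hzb : z ∈ unitBall n := mem_ball_zero_iff.2 (hz.trans_lt hr)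
  have hNh : 0 ≤ N * h := by positivity
  rw [← hF.transition_transition hs (show s ≤ s + N * h by linarith) ht hzb]
  exact (hF.norm_transition_le (by linarith) ht (hF.transition_mapsTo hs (by linarith) hzb)).trans
    ((hiter N s hs z hz).trans hN.le)

/-- As `F_t(w) = e^t (w + O(‖w‖²))` for the small points `w = F_t⁻¹(F_0(z))`, boundedness of
`F_t(w) = F_0(z)` forces `‖w‖ = O(e^{-t})`, so the error `e^t ‖w‖²` tends to zero. -/
theorem tendstoLocallyUniformlyOn_exp_smul_transition (hF : IsLoewnerChain F)
    (hb : IsTailBounded F) :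
    TendstoLocallyUniformlyOn (fun (t : ℝ) (z : Cn n) => Real.exp t • transition F 0 t z) (F 0)
      atTop (unitBall n) := by
  obtain ⟨U, M, hU, hM0, hM⟩ := hb
  rw [Metric.tendstoLocallyUniformlyOn_iff]
  intro ε hε z hz
  obtain ⟨r, hzr, hr⟩ := exists_between (mem_ball_zero_iff.1 hz)
  obtain ⟨B, hB⟩ := (isCompact_closedBall (0 : Cn n) r).exists_bound_of_continuousOn
    ((hF.differentiableOn 0 le_rfl).continuousOn.mono (Metric.closedBall_subset_ball hr))
  set δ := 1 / (32 * M + 4) with hδ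
  have hδ0 : 0 < δ := by positivity
  have hδ1 : 16 * M * δ ≤ 1 / 2 := by
    rw [hδ, mul_one_div, div_le_iff₀ (by positivity)]; linarith
  have hδ2 : δ < 1 / 2 := by
    rw [hδ]; exact one_div_lt_one_div_of_lt (by norm_num) (by linarith)
  obtain ⟨T, hT0, hT⟩ := hF.exists_norm_transition_le hr hδ0
  have hlim : Tendsto (fun t : ℝ => 16 * M * (2 * B) ^ 2 * Real.exp (-t)) atTop (𝓝 0) := by
    simpa using Real.tendsto_exp_neg_atTop_nhds_zero.const_mul (16 * M * (2 * B) ^ 2)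
  refine ⟨Metric.ball 0 r, mem_nhdsWithin_of_mem_nhds
    (Metric.isOpen_ball.mem_nhds (mem_ball_zero_iff.2 hzr)), ?_⟩
  filter_upwards [hlim.eventually (gt_mem_nhds hε), eventually_ge_atTop U, eventually_ge_atTop T]
    with t ht htU htT y hy
  have ht0 : 0 ≤ t := hU.trans htU
  rw [mem_ball_zero_iff] at hy
  have hyb : y ∈ unitBall n := mem_ball_zero_iff.2 (hy.trans hr)
  have hw := hT 0 t le_rfl (by linarith) y hy.le
  set w := transition F 0 t y with hwdef
  have h1 := hF.norm_sub_exp_smul_le ht0 (hM t htU) (hw.trans_lt hδ2)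
  rw [hwdef, hF.apply_transition le_rfl ht0 hyb, ← hwdef] at h1
  have hE := Real.exp_pos t
  have h2 : 16 * M * Real.exp t * ‖w‖ ^ 2 ≤ Real.exp t * ‖w‖ / 2 := by
    have : 16 * M * ‖w‖ ≤ 1 / 2 := (mul_le_mul_of_nonneg_left hw (by positivity)).trans hδ1
    have h3 := mul_le_mul_of_nonneg_left this (show 0 ≤ Real.exp t * ‖w‖ by positivity)
    linarith
  have h3 : Real.exp t * ‖w‖ ≤ 2 * B := by
    have h4 := norm_sub_norm_le (Real.exp t • w) (F 0 y)
    rw [norm_sub_rev, norm_smul, Real.norm_of_nonneg hE.le] at h4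
    linarith [hB y (mem_closedBall_zero_iff.2 hy.le)]
  rw [dist_eq_norm]
  calc _ ≤ 16 * M * Real.exp t * ‖w‖ ^ 2 := h1
    _ = 16 * M * (Real.exp t * ‖w‖) ^ 2 * Real.exp (-t) := by
        rw [Real.exp_neg]; field_simp
    _ ≤ 16 * M * (2 * B) ^ 2 * Real.exp (-t) := by gcongr
    _ < ε := ht

/-- The initial element of a Loewner chain with bounded tail has parametric representation. -/
theorem mem_classS0 (hF : IsLoewnerChain F) (hb : IsTailBounded F) {g : Hol n}
    (hg : EqOn g (F 0) (unitBall n)) : g ∈ classS0 n := by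
  have h0 := zero_mem_unitBall n
  refine ⟨⟨?_, ?_, ?_⟩, ?_⟩
  · rw [hg h0, hF.map_zero 0 le_rfl]
  · have := hF.hasFDerivAt 0 le_rfl
    rw [Real.exp_zero, Complex.ofReal_one, one_smul] at this
    exact this.congr_of_eventuallyEq (hg.eventuallyEq_of_mem (unitBall_mem_nhds h0))
  · exact (hF.injOn 0 le_rfl).congr hg.symm
  · obtain ⟨G, hG, hφ⟩ := hF.exists_isHerglotz_solvesLoewnerODE
    exact ⟨G, _, hG, hφ, (hF.tendstoLocallyUniformlyOn_exp_smul_transition hb).congr_right hg.symm⟩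

/-- Transition maps over short times are Lipschitz close to the identity, and the others are
compositions of these. -/
theorem injective_fderiv_transition (hF : IsLoewnerChain F) (hs : 0 ≤ s) (hst : s ≤ t)
    (hz : z ∈ unitBall n) : Function.Injective (fderiv ℂ (transition F s t) z) := by
  obtain ⟨r, hzr, hr⟩ := exists_between (mem_ball_zero_iff.1 hz)
  have hr' : 0 < 1 - r := by linarith
  set K := 128 / (1 - r) ^ 3 with hK
  have hK0 : 0 < K := by positivity
  have hshort : ∀ a b, 0 ≤ a → a ≤ b → b ≤ a + 1 / (2 * K) → ∀ x : Cn n, ‖x‖ < r →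
      Function.Injective (fderiv ℂ (transition F a b) x) := by
    intro a b ha hab hb x hx
    have hxb : x ∈ unitBall n := mem_ball_zero_iff.2 (hx.trans hr)
    refine injective_of_norm_sub_smul_id_le one_ne_zero ?_
    rw [one_smul, norm_one]
    have hd := (((hF.transition_differentiableOn ha hab).differentiableAt
      (unitBall_mem_nhds hxb)).hasFDerivAt).sub (hasFDerivAt_id (𝕜 := ℂ) x)
    refine hd.le_of_lip' (by norm_num) ?_
    filter_upwards [Metric.isOpen_ball.mem_nhds (mem_ball_zero_iff.2 hx)] with y hy
    refine (hF.norm_transition_sub_sub_le ha hab hr (mem_ball_zero_iff.1 hy).le hx.le).trans ?_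
    refine mul_le_mul_of_nonneg_right ?_ (norm_nonneg _)
    calc (b - a) * K ≤ 1 / (2 * K) * K := by gcongr; linarith
      _ = 1 / 2 := by clear_value K; field_simp
  have hN : ∀ N : ℕ, ∀ a b, 0 ≤ a → a ≤ b → b ≤ a + (N + 1) * (1 / (2 * K)) → ∀ x : Cn n,
      ‖x‖ < r → Function.Injective (fderiv ℂ (transition F a b) x) := by
    intro N
    induction N with
    | zero =>
      intro a b ha hab hb
      exact hshort a b ha hab (by simpa using hb)
    | succ N ih =>
      intro a b ha hab hb x hx
      rcases le_total b (a + 1 / (2 * K)) with h | h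
      · exact hshort a b ha hab h x hx
      have hxb : x ∈ unitBall n := mem_ball_zero_iff.2 (hx.trans hr)
      set c := a + 1 / (2 * K) with hc
      have hac : a ≤ c := by rw [hc]; linarith [show 0 < 1 / (2 * K) by positivity]
      have hxc := hF.transition_mapsTo ha hac hxb
      have hd1 := ((hF.transition_differentiableOn ha hac).differentiableAt
        (unitBall_mem_nhds hxb)).hasFDerivAt
      have hd2 := ((hF.transition_differentiableOn (ha.trans hac) h).differentiableAt
        (unitBall_mem_nhds hxc)).hasFDerivAt
      have hd3 := (hd2.comp x hd1).congr_of_eventuallyEq (f₁ := transition F a b) <| by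
        filter_upwards [unitBall_mem_nhds hxb] with y hy
        exact (hF.transition_transition ha hac h hy).symm
      rw [hd3.fderiv, ContinuousLinearMap.coe_comp]
      refine (ih c b (ha.trans hac) h ?_ _ ?_).comp (hshort a c ha hac le_rfl x hx)
      · push_cast at hb
        linarith
      · exact (hF.norm_transition_le ha hac hxb).trans_lt hx
  obtain ⟨N, hNt⟩ := exists_nat_ge ((t - s) / (1 / (2 * K)))
  refine hN N s t hs hst ?_ z hzr
  have hpos : 0 < 1 / (2 * K) := by positivity
  rw [div_le_iff₀ hpos] at hNt
  linarith

/-- The maps of a Loewner chain with bounded tail have injective differentials. -/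
theorem injective_fderiv (hF : IsLoewnerChain F) (hb : IsTailBounded F) (hs : 0 ≤ s)
    (hz : z ∈ unitBall n) : Function.Injective (fderiv ℂ (F s) z) := by
  obtain ⟨U, M, hU, hM0, hM⟩ := hb
  set δ := 1 / (256 * M + 8) with hδ
  have hδ0 : 0 < δ := by positivity
  have hδ1 : 128 * M * δ ≤ 1 / 2 := by
    rw [hδ, mul_one_div, div_le_iff₀ (by positivity)]; linarith
  have hδ2 : δ < 1 / 4 := by
    rw [hδ]; exact one_div_lt_one_div_of_lt (by norm_num) (by linarith)
  obtain ⟨T, hT0, hT⟩ := hF.exists_norm_transition_le (mem_ball_zero_iff.1 hz) hδ0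
  set t := s + T + U with ht
  have hst : s ≤ t := by linarith
  have ht0 : 0 ≤ t := hs.trans hst
  have hw := hT s t hs (by linarith) z le_rfl
  have hwb := hF.transition_mapsTo hs hst hz
  set w := transition F s t z with hwdef
  have hd1 := ((hF.transition_differentiableOn hs hst).differentiableAt
    (unitBall_mem_nhds hz)).hasFDerivAt
  have hd2 := ((hF.differentiableOn t ht0).differentiableAt (unitBall_mem_nhds hwb)).hasFDerivAt
  have hd3 := (hd2.comp z hd1).congr_of_eventuallyEq (f₁ := F s) <| by
    filter_upwards [unitBall_mem_nhds hz] with y hy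
    exact (hF.apply_transition hs hst hy).symm
  rw [hd3.fderiv, ContinuousLinearMap.coe_comp]
  refine Function.Injective.comp ?_ (hF.injective_fderiv_transition hs hst hz)
  have hE := Real.exp_pos t
  have hEn : ‖((Real.exp t : ℝ) : ℂ)‖ = Real.exp t := by
    rw [Complex.norm_real, Real.norm_of_nonneg hE.le]
  refine injective_of_norm_sub_smul_id_le (c := ((Real.exp t : ℝ) : ℂ))
    (by exact_mod_cast hE.ne') ?_
  rw [hEn]
  have hA : HasFDerivAt (⇑(((Real.exp t : ℝ) : ℂ) • ContinuousLinearMap.id ℂ (Cn n)))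
      (((Real.exp t : ℝ) : ℂ) • ContinuousLinearMap.id ℂ (Cn n)) w :=
    ContinuousLinearMap.hasFDerivAt _
  have hd4 := hd2.sub hA
  rw [← hd4.fderiv]
  have hsub : ∀ x ∈ Metric.ball w δ, ‖x‖ ≤ 2 * δ := by
    intro x hx
    rw [mem_ball_iff_norm] at hx
    linarith [norm_le_norm_sub_add x w]
  refine (norm_fderiv_le_of_norm_le_on_ball (M := 16 * M * Real.exp t * (2 * δ) ^ 2) hδ0
    (((hF.differentiableOn t ht0).sub
      (ContinuousLinearMap.differentiable _).differentiableOn).mono fun x hx => ?_)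
    fun x hx => ?_).trans ?_
  · rw [mem_ball_zero_iff]
    linarith [hsub x hx]
  · have h1 := hF.norm_sub_exp_smul_le ht0 (hM t (by linarith)) (w := x)
      (by linarith [hsub x hx])
    rw [Pi.sub_apply, ofReal_smul_id_apply]
    refine h1.trans ?_
    have := hsub x hx
    gcongr
  · calc 2 * (16 * M * Real.exp t * (2 * δ) ^ 2) / δ = (128 * M * δ) * Real.exp t := by
          clear_value δ; field_simp; ring
      _ ≤ 1 / 2 * Real.exp t := by gcongr
      _ = _ := by ring

end IsLoewnerChain

/-! ### Perturbing and interpolating -/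

section Perturbation

variable {n : ℕ}

/-- A small perturbation of a biholomorphic map factors, over a smaller ball, through the map
itself by a map that is close to the identity. -/
theorem exists_factor_of_perturbation {Q g : Cn n → Cn n} (hQ : DifferentiableOn ℂ Q (unitBall n))
    (hinj : InjOn Q (unitBall n)) (hQ' : ∀ z ∈ unitBall n, Function.Injective (fderiv ℂ Q z))
    (hg : DifferentiableOn ℂ g (unitBall n)) {ρ η : ℝ} (hρ : ρ < 1) (hη : 0 < η) :
    ∃ ε₀ > 0, ∀ ε : ℂ, ‖ε‖ ≤ ε₀ → ∃ κ : Cn n → Cn n,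
      DifferentiableOn ℂ κ (Metric.ball 0 ρ) ∧ MapsTo κ (Metric.ball 0 ρ) (unitBall n) ∧
      (∀ w ∈ Metric.ball (0 : Cn n) ρ, Q (κ w) = Q w + ε • g w) ∧
      ∀ x ∈ Metric.ball (0 : Cn n) ρ, ∀ y ∈ Metric.ball (0 : Cn n) ρ,
        ‖(κ x - x) - (κ y - y)‖ ≤ η * ‖x - y‖ := by
  obtain ⟨p, hopen, hp, hpd⟩ := exists_holomorphic_inverse Metric.isOpen_ball hQ hinj hQ'
  set R := (1 + ρ) / 2 with hR
  have hRB : Metric.closedBall (0 : Cn n) R ⊆ unitBall n :=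
    Metric.closedBall_subset_ball (by linarith)
  set η' := η * (R - ρ) / 2 with hη'
  have hRρ : 0 < R - ρ := by rw [hR]; linarith
  have hη'0 : 0 < η' := by positivity
  have hev : ∀ᶠ ε : ℂ in 𝓝 0, ∀ w ∈ Metric.closedBall (0 : Cn n) R,
      Q w + ε • g w ∈ Q '' unitBall n ∧ ‖p (Q w + ε • g w) - w‖ < η' := by
    refine (isCompact_closedBall (0 : Cn n) R).eventually_forall_of_forall_eventually
      fun w hw => ?_
    have hwB := hRB hw
    have hcont : ContinuousAt (fun x : ℂ × Cn n => Q x.2 + x.1 • g x.2) (0, w) := by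
      have h1 : ContinuousAt Q w := (hQ.differentiableAt (unitBall_mem_nhds hwB)).continuousAt
      have h2 : ContinuousAt g w := (hg.differentiableAt (unitBall_mem_nhds hwB)).continuousAt
      exact (h1.comp' continuousAt_snd).add (continuousAt_fst.smul (h2.comp' continuousAt_snd))
    have hmem : Q '' unitBall n ∈ 𝓝 (Q w + (0 : ℂ) • g w) := by
      rw [zero_smul, add_zero]
      exact hopen.mem_nhds ⟨w, hwB, rfl⟩
    have hpc : ContinuousAt p (Q w + (0 : ℂ) • g w) := (hpd.differentiableAt hmem).continuousAt
    have hcont2 : ContinuousAt (fun x : ℂ × Cn n => ‖p (Q x.2 + x.1 • g x.2) - x.2‖) (0, w) :=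
      ((ContinuousAt.comp' (f := fun x : ℂ × Cn n => Q x.2 + x.1 • g x.2) (x := (0, w))
        hpc hcont).sub continuousAt_snd).norm
    refine (hcont.eventually hmem).and (hcont2.eventually (gt_mem_nhds ?_))
    simpa [hp w hwB] using hη'0
  obtain ⟨ε₁, hε₁, h⟩ := Metric.eventually_nhds_iff.1 hev
  refine ⟨ε₁ / 2, by positivity, fun ε hε => ?_⟩
  have hε' := h (y := ε) (by rw [dist_zero_right]; linarith)
  have hsub : Metric.ball (0 : Cn n) R ⊆ Metric.closedBall 0 R := Metric.ball_subset_closedBall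
  have hρR : Metric.ball (0 : Cn n) ρ ⊆ Metric.ball 0 R := Metric.ball_subset_ball (by linarith)
  have hd : DifferentiableOn ℂ (fun w => p (Q w + ε • g w)) (Metric.ball 0 R) :=
    hpd.comp ((hQ.mono (hsub.trans hRB)).add ((hg.mono (hsub.trans hRB)).const_smul ε))
      fun w hw => (hε' w (hsub hw)).1
  refine ⟨fun w => p (Q w + ε • g w), hd.mono hρR, fun w hw => ?_, fun w hw => ?_,
    fun x hx y hy => ?_⟩
  · obtain ⟨v, hv, he⟩ := (hε' w (hsub (hρR hw))).1
    change p _ ∈ _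
    rwa [← he, hp v hv]
  · obtain ⟨v, hv, he⟩ := (hε' w (hsub (hρR hw))).1
    change Q (p _) = _
    rw [← he, hp v hv]
  · have h1 := norm_sub_le_of_norm_le_on_ball (f := fun w => p (Q w + ε • g w) - w) (r := ρ)
      (by linarith) (hd.sub differentiableOn_id) (fun w hw => (hε' w (hsub hw)).2.le)
      (Metric.ball_subset_closedBall hx) (Metric.ball_subset_closedBall hy)
    refine h1.trans (le_of_eq ?_)
    rw [hη']
    clear_value R
    field_simp

/-- The maps `e^{-x}(id + (x / b) k)`, which interpolate between the identity, at `x = 0`, and a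
contracted perturbation of the identity, at `x = b`. -/
noncomputable def interpolation (k : Cn n → Cn n) (b x : ℝ) (z : Cn n) : Cn n :=
  Real.exp (-x) • (z + (x / b) • k z)

theorem HasFDerivAt.comp_smul_id {f g : Cn n → Cn n} {a b : ℝ}
    (hf : HasFDerivAt f (((a : ℝ) : ℂ) • ContinuousLinearMap.id ℂ (Cn n)) 0)
    (hg : HasFDerivAt g (((b : ℝ) : ℂ) • ContinuousLinearMap.id ℂ (Cn n)) 0) (h0 : g 0 = 0) :
    HasFDerivAt (fun z => f (g z)) (((a * b : ℝ) : ℂ) • ContinuousLinearMap.id ℂ (Cn n)) 0 := by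
  rw [← h0] at hf
  have e : ((a * b : ℝ) : ℂ) • ContinuousLinearMap.id ℂ (Cn n) =
      ((a : ℂ) • ContinuousLinearMap.id ℂ (Cn n)).comp ((b : ℂ) • ContinuousLinearMap.id ℂ (Cn n)) := by
    ext1 v
    simp only [ContinuousLinearMap.comp_apply, smul_apply, ContinuousLinearMap.id_apply, smul_smul]
    push_cast
    rfl
  rw [e]
  exact hf.comp (0 : Cn n) hg

theorem hasFDerivAt_real_smul (a : ℝ) (z : Cn n) :
    HasFDerivAt (fun z : Cn n => a • z) (((a : ℝ) : ℂ) • ContinuousLinearMap.id ℂ (Cn n)) z := by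
  have := (hasFDerivAt_id (𝕜 := ℂ) z).const_smul (a : ℂ)
  refine this.congr_of_eventuallyEq (Eventually.of_forall fun w => ?_)
  simp

section Interpolation

variable {k : Cn n → Cn n} {b η x y : ℝ}

theorem interpolation_apply_zero (h0 : k 0 = 0) : interpolation k b x 0 = 0 := by
  simp [interpolation, h0]

theorem differentiableOn_interpolation (hk : DifferentiableOn ℂ k (unitBall n)) :
    DifferentiableOn ℂ (interpolation k b x) (unitBall n) :=
  (differentiableOn_id.add (hk.const_smul (x / b))).const_smul (Real.exp (-x))

theorem hasFDerivAt_interpolation (hk' : HasFDerivAt k (0 : Cn n →L[ℂ] Cn n) 0) :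
    HasFDerivAt (interpolation k b x)
      (((Real.exp (-x) : ℝ) : ℂ) • ContinuousLinearMap.id ℂ (Cn n)) 0 := by
  have h := ((hasFDerivAt_id (𝕜 := ℂ) (0 : Cn n)).add (hk'.const_smul (((x / b : ℝ) : ℂ)))).const_smul
    ((Real.exp (-x) : ℝ) : ℂ)
  rw [smul_zero, add_zero] at h
  refine h.congr_of_eventuallyEq (Eventually.of_forall fun w => ?_)
  simp only [interpolation, Pi.smul_apply, Pi.add_apply, id, Complex.coe_smul]

theorem injOn_interpolation (hL : ∀ z ∈ unitBall n, ∀ w ∈ unitBall n, ‖k z - k w‖ ≤ η * ‖z - w‖)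
    (hη1 : η < 1) (hx : 0 ≤ x) (hxb : x ≤ b) : InjOn (interpolation k b x) (unitBall n) := by
  intro z hz w hw h
  have h1 : z + (x / b) • k z = w + (x / b) • k w :=
    smul_right_injective _ (Real.exp_pos (-x)).ne' h
  have h2 : z - w = (x / b) • (k w - k z) := by
    rw [smul_sub, sub_eq_sub_iff_add_eq_add, h1, add_comm]
  have hδ : 0 ≤ x / b := div_nonneg hx (hx.trans hxb)
  have hδ1 : x / b ≤ 1 := div_le_one_of_le₀ hxb (hx.trans hxb)
  have h3 : ‖z - w‖ ≤ η * ‖z - w‖ := by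
    calc ‖z - w‖ = x / b * ‖k z - k w‖ := by
          rw [h2, norm_smul, Real.norm_of_nonneg hδ, norm_sub_rev]
      _ ≤ 1 * ‖k z - k w‖ := by gcongr
      _ ≤ η * ‖z - w‖ := by rw [one_mul]; exact hL z hz w hw
  have h4 : ‖z - w‖ = 0 := by nlinarith [norm_nonneg (z - w)]
  exact sub_eq_zero.1 (norm_eq_zero.1 h4)

theorem norm_interpolation_le (h0 : k 0 = 0)
    (hL : ∀ z ∈ unitBall n, ∀ w ∈ unitBall n, ‖k z - k w‖ ≤ η * ‖z - w‖)
    (hb : 0 < b) (hηb : η * (1 / b + 3) ≤ 1) (hη : 0 < η) (hx : 0 ≤ x) {z : Cn n}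
    (hz : z ∈ unitBall n) : ‖interpolation k b x z‖ ≤ ‖z‖ := by
  have h1 := hL z hz 0 (zero_mem_unitBall n)
  rw [h0, sub_zero, sub_zero] at h1
  have hδ : 0 ≤ x / b := div_nonneg hx hb.le
  have hηb' : η / b ≤ 1 := by rw [div_eq_mul_one_div]; linarith
  rw [interpolation, norm_smul, Real.norm_of_nonneg (Real.exp_pos _).le, Real.exp_neg,
    inv_mul_le_iff₀ (Real.exp_pos _)]
  calc ‖z + (x / b) • k z‖ ≤ ‖z‖ + x / b * ‖k z‖ := by
        refine (norm_add_le _ _).trans_eq ?_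
        rw [norm_smul, Real.norm_of_nonneg hδ]
    _ ≤ ‖z‖ + x / b * (η * ‖z‖) := by gcongr
    _ = (1 + x * (η / b)) * ‖z‖ := by ring
    _ ≤ Real.exp x * ‖z‖ := by
        gcongr
        nlinarith [Real.add_one_le_exp x]

theorem injective_fderiv_interpolation (hk : DifferentiableOn ℂ k (unitBall n))
    (hL : ∀ z ∈ unitBall n, ∀ w ∈ unitBall n, ‖k z - k w‖ ≤ η * ‖z - w‖)
    (hη1 : η ≤ 1 / 2) (hx : 0 ≤ x) (hxb : x ≤ b) {z : Cn n} (hz : z ∈ unitBall n) :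
    Function.Injective (fderiv ℂ (interpolation k b x) z) := by
  have hE := Real.exp_pos (-x)
  have hδ : 0 ≤ x / b := div_nonneg hx (hx.trans hxb)
  have hδ1 : x / b ≤ 1 := div_le_one_of_le₀ hxb (hx.trans hxb)
  refine injective_of_norm_sub_smul_id_le (c := ((Real.exp (-x) : ℝ) : ℂ))
    (by exact_mod_cast hE.ne') ?_
  rw [Complex.norm_real, Real.norm_of_nonneg hE.le]
  have hd := (((differentiableOn_interpolation (b := b) (x := x) hk).differentiableAt
    (unitBall_mem_nhds hz)).hasFDerivAt).sub (hasFDerivAt_real_smul (Real.exp (-x)) z)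
  refine hd.le_of_lip' (by positivity) ?_
  filter_upwards [unitBall_mem_nhds hz] with w hw
  have h1 : (interpolation k b x - fun z => Real.exp (-x) • z : Cn n → Cn n) w -
      (interpolation k b x - fun z => Real.exp (-x) • z : Cn n → Cn n) z =
      (Real.exp (-x) * (x / b)) • (k w - k z) := by
    simp only [Pi.sub_apply, interpolation]
    module
  rw [h1, norm_smul, Real.norm_of_nonneg (by positivity)]
  calc _ ≤ Real.exp (-x) * 1 * (1 / 2 * ‖w - z‖) := by
        have := (hL w hw z hz).trans (mul_le_mul_of_nonneg_right hη1 (norm_nonneg _))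
        gcongr
    _ = _ := by ring

/-- The interpolating maps are subordinate to each other: `E_y(w) = E_x(z)` is a fixed point
equation for `w`, solved by contraction on the ball with centre `e^{y-x} z` that is internally
tangent at `z` to the ball of radius `‖z‖`; hence `‖w‖ ≤ ‖z‖`. -/
theorem subordinate_interpolation (hk : DifferentiableOn ℂ k (unitBall n)) (h0 : k 0 = 0)
    (hL : ∀ z ∈ unitBall n, ∀ w ∈ unitBall n, ‖k z - k w‖ ≤ η * ‖z - w‖)
    (hb : 0 < b) (hηb : η * (1 / b + 3) ≤ 1) (hη : 0 < η) (hy : 0 ≤ y) (hyx : y ≤ x)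
    (hxb : x ≤ b) : Subordinate (interpolation k b x) (interpolation k b y) := by
  have hη3 : η * 3 ≤ 1 := by
    have : 0 ≤ η * (1 / b) := by positivity
    linarith
  set q := Real.exp (y - x) with hq
  have hq0 : 0 < q := Real.exp_pos _
  have hq1 : q ≤ 1 := by rw [hq, Real.exp_le_one_iff]; linarith
  have hδx : 0 ≤ x / b := div_nonneg (hy.trans hyx) hb.le
  have hδy : 0 ≤ y / b := div_nonneg hy hb.le
  have hδy1 : y / b ≤ 1 := div_le_one_of_le₀ (hyx.trans hxb) hb.le
  have hsol : ∀ z ∈ unitBall n, ∃ w : Cn n, ‖w‖ ≤ ‖z‖ ∧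
      w + (y / b) • k w = q • (z + (x / b) • k z) := by
    intro z hz
    have hz1 := mem_ball_zero_iff.1 hz
    have hkz := hL z hz 0 (zero_mem_unitBall n)
    rw [h0, sub_zero, sub_zero] at hkz
    set S := Metric.closedBall (q • z) ((1 - q) * ‖z‖) with hS
    have hSnorm : ∀ w ∈ S, ‖w‖ ≤ ‖z‖ := by
      intro w hw
      rw [hS, mem_closedBall_iff_norm] at hw
      have h1 := norm_le_norm_sub_add w (q • z)
      rw [norm_smul, Real.norm_of_nonneg hq0.le] at h1
      linarith
    have hSB : S ⊆ unitBall n := fun w hw => mem_ball_zero_iff.2 ((hSnorm w hw).trans_lt hz1)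
    let Θ : Cn n → Cn n := fun w => q • (z + (x / b) • k z) - (y / b) • k w
    have hmaps : MapsTo Θ S S := by
      intro w hw
      have hzw : ‖z - w‖ ≤ 2 * (1 - q) * ‖z‖ := by
        have h1 : z - w = (1 - q) • z - (w - q • z) := by module
        rw [h1]
        refine (norm_sub_le _ _).trans ?_
        rw [norm_smul, Real.norm_of_nonneg (by linarith)]
        linarith [mem_closedBall_iff_norm.1 hw]
      have hkzw := hL z hz w (hSB hw)
      have hcoef : |q * (x / b) - y / b| ≤ (1 - q) * (1 / b + 1) := by
        have h1 : q * (1 + (x - y)) ≤ 1 := by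
          have h2 := Real.add_one_le_exp (x - y)
          have h3 : q * Real.exp (x - y) = 1 := by
            rw [hq, ← Real.exp_add]; simp
          nlinarith
        have h2 : q * (x / b) - y / b = q * (x - y) * (1 / b) - (1 - q) * (y / b) := by ring
        have h3 : 0 ≤ q * (x - y) * (1 / b) := by
          have : 0 ≤ x - y := by linarith
          positivity
        have h4 : 0 ≤ (1 - q) * (y / b) := mul_nonneg (by linarith) hδy
        have h5 : q * (x - y) * (1 / b) ≤ (1 - q) * (1 / b) := by
          gcongr
          linarith
        have h6 : (1 - q) * (y / b) ≤ (1 - q) * 1 := mul_le_mul_of_nonneg_left hδy1 (by linarith)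
        have h7 : 0 ≤ (1 - q) * (1 / b) := mul_nonneg (by linarith) (by positivity)
        rw [h2, abs_le]
        constructor <;> linarith
      rw [hS, mem_closedBall_iff_norm]
      have h1 : Θ w - q • z = (q * (x / b) - y / b) • k z + (y / b) • (k z - k w) := by
        simp only [Θ]
        module
      rw [h1]
      calc _ ≤ |q * (x / b) - y / b| * ‖k z‖ + y / b * ‖k z - k w‖ := by
            refine (norm_add_le _ _).trans_eq ?_
            rw [norm_smul, norm_smul, Real.norm_eq_abs, Real.norm_of_nonneg hδy]
        _ ≤ (1 - q) * (1 / b + 1) * (η * ‖z‖) + 1 * (η * (2 * (1 - q) * ‖z‖)) := by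
            have h2 : 0 ≤ 1 - q := by linarith
            gcongr
            exact hkzw.trans (mul_le_mul_of_nonneg_left hzw hη.le)
        _ = (η * (1 / b + 3)) * ((1 - q) * ‖z‖) := by ring
        _ ≤ 1 * ((1 - q) * ‖z‖) :=
            mul_le_mul_of_nonneg_right hηb (mul_nonneg (by linarith) (norm_nonneg _))
        _ = _ := one_mul _
    have hcontr : ContractingWith η.toNNReal (hmaps.restrict Θ S S) := by
      refine ⟨?_, LipschitzWith.of_dist_le_mul fun v w => ?_⟩
      · rw [Real.toNNReal_lt_one]; linarith
      · rw [Real.coe_toNNReal _ hη.le, Subtype.dist_eq, Subtype.dist_eq, dist_eq_norm, dist_eq_norm]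
        have h1 : Θ v - Θ w = (y / b) • (k w - k v) := by
          simp only [Θ]
          module
        change ‖Θ v - Θ w‖ ≤ _
        rw [h1, norm_smul, Real.norm_of_nonneg hδy, norm_sub_rev]
        calc _ ≤ 1 * ‖k v - k w‖ := by gcongr
          _ ≤ _ := by rw [one_mul]; exact hL v (hSB v.2) w (hSB w.2)
    have hqz : q • z ∈ S := Metric.mem_closedBall_self (mul_nonneg (by linarith) (norm_nonneg _))
    obtain ⟨w, hwS, hfix, -⟩ := hcontr.exists_fixedPoint' Metric.isClosed_closedBall.isComplete
      hmaps hqz (edist_ne_top _ _)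
    refine ⟨w, hSnorm w hwS, ?_⟩
    have h1 : Θ w = w := hfix
    have h2 := sub_eq_iff_eq_add.1 h1
    exact h2.symm
  choose! w hw hws using hsol
  have hmapsB : MapsTo w (unitBall n) (unitBall n) := fun z hz =>
    mem_ball_zero_iff.2 ((hw z hz).trans_lt (mem_ball_zero_iff.1 hz))
  have heq : ∀ z ∈ unitBall n, interpolation k b y (w z) = interpolation k b x z := by
    intro z hz
    rw [interpolation, hws z hz, smul_smul, interpolation, hq, ← Real.exp_add]
    congr 2
    ring
  refine ⟨w, ?_, hmapsB, ?_, fun z hz => (heq z hz).symm⟩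
  · exact differentiableOn_of_comp_eq Metric.isOpen_ball (differentiableOn_interpolation hk)
      (injOn_interpolation hL (by linarith) hy (hyx.trans hxb))
      (fun z hz => injective_fderiv_interpolation hk hL (by linarith) hy (hyx.trans hxb) hz)
      (differentiableOn_interpolation hk) hmapsB heq
  · have := hw 0 (zero_mem_unitBall n)
    rwa [norm_zero, norm_le_zero_iff] at this

end Interpolation

end Perturbation

/-! ### Perturbing a squeezed chain -/

namespace IsLoewnerChain

variable {n : ℕ} {F : ℝ → Cn n → Cn n} {s t : ℝ} {z : Cn n} {T A a : ℝ}

/-- The extra time `a (s - T)⁺` by which the accelerated clock `s + a (s - T)⁺` is ahead at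
time `s`. The same number is the logarithm of the dilation factor in `dilatedTransition`. -/
noncomputable def timeLead (T a s : ℝ) : ℝ := a * max (s - T) 0

/-- The transition maps of a chain that is squeezed with exponent `a` from time `T` on, run from then
on along the accelerated clock and conjugated by dilations. Acceleration and dilation balance, so
the differential at the origin is still `e^{s - t} id`. -/
noncomputable def dilatedTransition (F : ℝ → Cn n → Cn n) (T a s t : ℝ) (z : Cn n) : Cn n :=
  Real.exp (timeLead T a t) • transition F (s + timeLead T a s) (t + timeLead T a t)
    (Real.exp (-timeLead T a s) • z)

theorem timeLead_nonneg (ha : 0 ≤ a) : 0 ≤ timeLead T a s := mul_nonneg ha (le_max_right _ _)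

theorem timeLead_mono (ha : 0 ≤ a) (hst : s ≤ t) : timeLead T a s ≤ timeLead T a t :=
  mul_le_mul_of_nonneg_left (max_le_max (by linarith) le_rfl) ha

theorem timeLead_of_le (hs : s ≤ T) : timeLead T a s = 0 := by
  rw [timeLead, max_eq_right (by linarith), mul_zero]

theorem timeLead_of_ge (hs : T ≤ s) : timeLead T a s = a * (s - T) := by
  rw [timeLead, max_eq_left (by linarith)]

theorem exp_neg_timeLead_smul_mem (ha : 0 ≤ a) (hz : z ∈ unitBall n) :
    Real.exp (-timeLead T a s) • z ∈ unitBall n := by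
  rw [mem_ball_zero_iff] at hz ⊢
  rw [norm_smul, Real.norm_of_nonneg (Real.exp_pos _).le]
  have h1 : Real.exp (-timeLead T a s) ≤ 1 := by
    rw [Real.exp_le_one_iff]; linarith [timeLead_nonneg (T := T) (s := s) ha]
  calc _ ≤ 1 * ‖z‖ := by gcongr
    _ < 1 := by rwa [one_mul]

/-- With the clock `s ↦ s + timeLead T a s` the squeezing compensates the dilation by
`e^{timeLead T a s}`. -/
theorem norm_transition_timeLead_le (hF : IsLoewnerChain F) (hT : 0 ≤ T) (ha : 0 ≤ a)
    (hsq : ∀ s t, T ≤ s → s < t → t ≤ A + timeLead T a A → ∀ z ∈ unitBall n,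
      ‖transition F s t z‖ ≤ Real.exp (a * (s - t)) * ‖z‖)
    (hs : 0 ≤ s) (hst : s ≤ t) (htA : t ≤ A) (hz : z ∈ unitBall n) :
    ‖transition F (s + timeLead T a s) (t + timeLead T a t) z‖ ≤
      Real.exp (timeLead T a s - timeLead T a t) * ‖z‖ := by
  have hlate : ∀ s, T ≤ s → s ≤ t → ∀ z ∈ unitBall n,
      ‖transition F (s + timeLead T a s) (t + timeLead T a t) z‖ ≤
        Real.exp (timeLead T a s - timeLead T a t) * ‖z‖ := by
    intro s hTs hst z hz
    have hs0 := timeLead_nonneg (T := T) (s := s) ha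
    rcases hst.eq_or_lt with rfl | hlt
    · rw [hF.transition_self (by linarith) hz]
      simp
    · have hmono := timeLead_mono (T := T) ha hst
      refine (hsq _ _ (by linarith) (by linarith) ?_ z hz).trans ?_
      · linarith [timeLead_mono (T := T) ha htA]
      · gcongr
        rw [timeLead_of_ge hTs, timeLead_of_ge (hTs.trans hst)]
        have : 0 ≤ a * (a * (t - s)) := mul_nonneg ha (mul_nonneg ha (by linarith))
        linarith
  rcases le_total T s with h | h
  · exact hlate s h hst z hz
  rcases le_total t T with h' | h'
  · rw [timeLead_of_le h, timeLead_of_le h']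
    simpa using hF.norm_transition_le hs hst hz
  · have h1 := hlate T le_rfl h' (transition F s T z) (hF.transition_mapsTo hs h hz)
    rw [timeLead_of_le le_rfl, add_zero, hF.transition_transition hs h
      (by linarith [timeLead_nonneg (T := T) (s := t) ha]) hz] at h1
    rw [timeLead_of_le h, add_zero]
    exact h1.trans (mul_le_mul_of_nonneg_left (hF.norm_transition_le hs h hz) (Real.exp_pos _).le)

theorem norm_dilatedTransition_le (hF : IsLoewnerChain F) (hT : 0 ≤ T) (ha : 0 ≤ a)
    (hsq : ∀ s t, T ≤ s → s < t → t ≤ A + timeLead T a A → ∀ z ∈ unitBall n,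
      ‖transition F s t z‖ ≤ Real.exp (a * (s - t)) * ‖z‖)
    (hs : 0 ≤ s) (hst : s ≤ t) (htA : t ≤ A) (hz : z ∈ unitBall n) :
    ‖dilatedTransition F T a s t z‖ ≤ ‖z‖ := by
  have h := norm_transition_timeLead_le hF hT ha hsq hs hst htA
    (exp_neg_timeLead_smul_mem (T := T) (s := s) ha hz)
  rw [norm_smul, Real.norm_of_nonneg (Real.exp_pos _).le, ← mul_assoc, ← Real.exp_add] at h
  rw [dilatedTransition, norm_smul, Real.norm_of_nonneg (Real.exp_pos _).le]
  calc _ ≤ Real.exp (timeLead T a t) *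
        (Real.exp (timeLead T a s - timeLead T a t + -timeLead T a s) * ‖z‖) := by gcongr
    _ = ‖z‖ := by
        rw [← mul_assoc, ← Real.exp_add]
        ring_nf
        simp

theorem dilatedTransition_mapsTo (hF : IsLoewnerChain F) (hT : 0 ≤ T) (ha : 0 ≤ a)
    (hsq : ∀ s t, T ≤ s → s < t → t ≤ A + timeLead T a A → ∀ z ∈ unitBall n,
      ‖transition F s t z‖ ≤ Real.exp (a * (s - t)) * ‖z‖)
    (hs : 0 ≤ s) (hst : s ≤ t) (htA : t ≤ A) :
    MapsTo (dilatedTransition F T a s t) (unitBall n) (unitBall n) := fun _ hz =>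
  mem_ball_zero_iff.2 ((norm_dilatedTransition_le hF hT ha hsq hs hst htA hz).trans_lt
    (mem_ball_zero_iff.1 hz))

theorem dilatedTransition_differentiableOn (hF : IsLoewnerChain F) (ha : 0 ≤ a)
    (hs : 0 ≤ s) (hst : s ≤ t) :
    DifferentiableOn ℂ (dilatedTransition F T a s t) (unitBall n) := by
  have hs0 := timeLead_nonneg (T := T) (s := s) ha
  have hmono := timeLead_mono (T := T) ha hst
  exact ((hF.transition_differentiableOn (by linarith) (by linarith)).comp
    (differentiableOn_id.const_smul (Real.exp (-timeLead T a s)))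
    fun _ hz => exp_neg_timeLead_smul_mem ha hz).const_smul (Real.exp (timeLead T a t))

theorem dilatedTransition_zero (hF : IsLoewnerChain F) (ha : 0 ≤ a)
    (hs : 0 ≤ s) (hst : s ≤ t) : dilatedTransition F T a s t 0 = 0 := by
  have hs0 := timeLead_nonneg (T := T) (s := s) ha
  have hmono := timeLead_mono (T := T) ha hst
  rw [dilatedTransition, smul_zero, hF.transition_zero (by linarith) (by linarith), smul_zero]

theorem dilatedTransition_hasFDerivAt (hF : IsLoewnerChain F) (ha : 0 ≤ a)
    (hs : 0 ≤ s) (hst : s ≤ t) :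
    HasFDerivAt (dilatedTransition F T a s t)
      (((Real.exp (s - t) : ℝ) : ℂ) • ContinuousLinearMap.id ℂ (Cn n)) 0 := by
  have hs0 := timeLead_nonneg (T := T) (s := s) ha
  have hmono := timeLead_mono (T := T) ha hst
  have h1 := (hF.transition_hasFDerivAt (s := s + timeLead T a s) (t := t + timeLead T a t)
    (by linarith) (by linarith)).comp_smul_id (hasFDerivAt_real_smul (Real.exp (-timeLead T a s)) 0)
    (smul_zero _)
  have h2 := (hasFDerivAt_real_smul (Real.exp (timeLead T a t)) 0).comp_smul_id h1
    (by rw [smul_zero, hF.transition_zero (by linarith) (by linarith)])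
  rw [← Real.exp_add, ← Real.exp_add] at h2
  rw [show timeLead T a t + (s + timeLead T a s - (t + timeLead T a t) + -timeLead T a s) = s - t
    by ring] at h2
  exact h2

theorem dilatedTransition_injOn (hF : IsLoewnerChain F) (ha : 0 ≤ a)
    (hs : 0 ≤ s) (hst : s ≤ t) :
    InjOn (dilatedTransition F T a s t) (unitBall n) := by
  intro z hz w hw h
  have hs0 := timeLead_nonneg (T := T) (s := s) ha
  have hmono := timeLead_mono (T := T) ha hst
  have hz' := exp_neg_timeLead_smul_mem (T := T) (s := s) ha hz
  have hw' := exp_neg_timeLead_smul_mem (T := T) (s := s) ha hw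
  have h1 := congrArg (F (t + timeLead T a t)) (smul_right_injective _ (Real.exp_pos _).ne' h)
  beta_reduce at h1
  rw [hF.apply_transition (by linarith) (by linarith) hz',
    hF.apply_transition (by linarith) (by linarith) hw'] at h1
  exact smul_right_injective _ (Real.exp_pos _).ne' (hF.injOn _ (by linarith) hz' hw' h1)

theorem dilatedTransition_dilatedTransition (hF : IsLoewnerChain F) (ha : 0 ≤ a) {u : ℝ}
    (hs : 0 ≤ s) (hst : s ≤ t) (htu : t ≤ u)
    (hz : z ∈ unitBall n) : dilatedTransition F T a t u (dilatedTransition F T a s t z) =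
      dilatedTransition F T a s u z := by
  have hs0 := timeLead_nonneg (T := T) (s := s) ha
  have hmono := timeLead_mono (T := T) ha hst
  have hmono' := timeLead_mono (T := T) ha htu
  rw [dilatedTransition, dilatedTransition, smul_smul, ← Real.exp_add, neg_add_cancel, Real.exp_zero,
    one_smul, hF.transition_transition (by linarith) (by linarith) (by linarith)
      (exp_neg_timeLead_smul_mem ha hz), dilatedTransition]

/-- The chain obtained from `F` by routing it through the perturbation: up to time `A` the
accelerated and dilated chain, up to time `A + a (A - T)` the interpolation, and from then on `F`
itself. -/
noncomputable def perturbedChain (F : ℝ → Cn n → Cn n) (k : Cn n → Cn n) (T A a s : ℝ) :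
    Cn n → Cn n :=
  if A + timeLead T a A ≤ s then F s
  else if A ≤ s then fun z =>
    F (A + timeLead T a A) (interpolation k (timeLead T a A) (A + timeLead T a A - s) z)
  else fun z => F (A + timeLead T a A)
    (interpolation k (timeLead T a A) (timeLead T a A) (dilatedTransition F T a s A z))

theorem isLoewnerChain_perturbedChain (hF : IsLoewnerChain F) (hT : 0 ≤ T) (ha : 0 < a)
    (hTA : T < A)
    (hsq : ∀ s t, T ≤ s → s < t → t ≤ A + timeLead T a A → ∀ z ∈ unitBall n,
      ‖transition F s t z‖ ≤ Real.exp (a * (s - t)) * ‖z‖)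
    {k : Cn n → Cn n} {η : ℝ} (hk : DifferentiableOn ℂ k (unitBall n)) (hk0 : k 0 = 0)
    (hk' : HasFDerivAt k (0 : Cn n →L[ℂ] Cn n) 0)
    (hL : ∀ z ∈ unitBall n, ∀ w ∈ unitBall n, ‖k z - k w‖ ≤ η * ‖z - w‖) (hη : 0 < η)
    (hηb : η * (1 / timeLead T a A + 3) ≤ 1) :
    IsLoewnerChain (perturbedChain F k T A a) := by
  have hb : 0 < timeLead T a A := by
    rw [timeLead_of_ge hTA.le]; exact mul_pos ha (by linarith)
  have hA : 0 ≤ A := hT.trans hTA.le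
  set b := timeLead T a A with hbdef
  set U := A + b with hU
  have hU0 : 0 ≤ U := by linarith
  have hη1 : η < 1 := by
    have : 0 ≤ η * (1 / b) := by positivity
    linarith
  have hEmaps : ∀ x, 0 ≤ x → MapsTo (interpolation k b x) (unitBall n) (unitBall n) :=
    fun x hx z hz => mem_ball_zero_iff.2 ((norm_interpolation_le hk0 hL hb hηb hη hx hz).trans_lt
      (mem_ball_zero_iff.1 hz))
  have hψmaps : ∀ s, 0 ≤ s → s ≤ A → MapsTo (dilatedTransition F T a s A) (unitBall n) (unitBall n) :=
    fun s hs hsA => dilatedTransition_mapsTo hF hT ha.le hsq hs hsA le_rfl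
  have h1 : ∀ s, U ≤ s → perturbedChain F k T A a s = F s := fun s hs => if_pos hs
  have h2 : ∀ s, A ≤ s → s < U →
      perturbedChain F k T A a s = fun z => F U (interpolation k b (U - s) z) := fun s hs hs' => by
    rw [perturbedChain, if_neg (not_le.2 hs'), if_pos hs]
  have h3 : ∀ s, s < A → perturbedChain F k T A a s =
      fun z => F U (interpolation k b b (dilatedTransition F T a s A z)) := fun s hs => by
    rw [perturbedChain, if_neg (not_le.2 (by linarith)), if_neg (not_le.2 hs)]
  have hcases : ∀ s, U ≤ s ∨ (A ≤ s ∧ s < U) ∨ s < A := fun s => by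
    rcases le_or_gt U s with h | h
    · exact Or.inl h
    · rcases le_or_gt A s with h' | h'
      · exact Or.inr (Or.inl ⟨h', h⟩)
      · exact Or.inr (Or.inr h')
  -- subordination within and between the three regimes
  have sE : ∀ x y, 0 ≤ y → y ≤ x → x ≤ b → Subordinate (fun z => F U (interpolation k b x z))
      (fun z => F U (interpolation k b y z)) := by
    intro x y hy hyx hxb
    obtain ⟨φ, hφ, hm, h0, he⟩ := subordinate_interpolation hk hk0 hL hb hηb hη hy hyx hxb
    exact ⟨φ, hφ, hm, h0, fun z hz => congrArg (F U) (he z hz)⟩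
  have sF : ∀ x, 0 ≤ x → Subordinate (fun z => F U (interpolation k b x z)) (F U) := fun x hx =>
    ⟨interpolation k b x, differentiableOn_interpolation hk, hEmaps x hx,
      interpolation_apply_zero hk0, fun z _ => rfl⟩
  have sψ : ∀ s, 0 ≤ s → s ≤ A →
      Subordinate (fun z => F U (interpolation k b b (dilatedTransition F T a s A z)))
        (fun z => F U (interpolation k b b z)) := fun s hs hsA =>
    ⟨dilatedTransition F T a s A, dilatedTransition_differentiableOn hF ha.le hs hsA, hψmaps s hs hsA,
      dilatedTransition_zero hF ha.le hs hsA, fun z _ => rfl⟩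
  refine ⟨fun t ht => ?_, fun t ht => ?_, fun t ht => ?_, fun t ht => ?_, fun s t hs hst => ?_⟩
  · rcases hcases t with h | ⟨h, h'⟩ | h
    · rw [h1 t h]; exact hF.differentiableOn t ht
    · rw [h2 t h h']
      exact (hF.differentiableOn U hU0).comp (differentiableOn_interpolation hk)
        (hEmaps _ (by linarith))
    · rw [h3 t h]
      exact (hF.differentiableOn U hU0).comp ((differentiableOn_interpolation hk).comp
        (dilatedTransition_differentiableOn hF ha.le ht h.le) (hψmaps t ht h.le))
        ((hEmaps b hb.le).comp (hψmaps t ht h.le))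
  · rcases hcases t with h | ⟨h, h'⟩ | h
    · rw [h1 t h]; exact hF.map_zero t ht
    · rw [h2 t h h']
      simp only [interpolation_apply_zero hk0, hF.map_zero U hU0]
    · rw [h3 t h]
      simp only [dilatedTransition_zero hF ha.le ht h.le, interpolation_apply_zero hk0,
        hF.map_zero U hU0]
  · rcases hcases t with h | ⟨h, h'⟩ | h
    · rw [h1 t h]; exact hF.hasFDerivAt t ht
    · rw [h2 t h h']
      have := (hF.hasFDerivAt U hU0).comp_smul_id (hasFDerivAt_interpolation (b := b)
        (x := U - t) hk') (interpolation_apply_zero hk0)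
      rw [← Real.exp_add] at this
      convert this using 4
      ring
    · rw [h3 t h]
      have h4 := (hasFDerivAt_interpolation (b := b) (x := b) hk').comp_smul_id
        (dilatedTransition_hasFDerivAt (T := T) hF ha.le ht h.le) (dilatedTransition_zero hF ha.le ht h.le)
      have := (hF.hasFDerivAt U hU0).comp_smul_id h4
        (by rw [dilatedTransition_zero hF ha.le ht h.le, interpolation_apply_zero hk0])
      rw [← Real.exp_add, ← Real.exp_add] at this
      convert this using 4
      rw [hU]
      ring
  · have hEinj : ∀ x, 0 ≤ x → x ≤ b →
        InjOn (fun z => F U (interpolation k b x z)) (unitBall n) := fun x hx hxb =>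
      (hF.injOn U hU0).comp (injOn_interpolation hL hη1 hx hxb) (hEmaps x hx)
    rcases hcases t with h | ⟨h, h'⟩ | h
    · rw [h1 t h]; exact hF.injOn t ht
    · rw [h2 t h h']
      exact hEinj _ (by linarith) (by linarith)
    · rw [h3 t h]
      exact (hEinj b hb.le le_rfl).comp (dilatedTransition_injOn hF ha.le ht h.le) (hψmaps t ht h.le)
  · rcases hcases s with h | ⟨h, h'⟩ | h
    · rw [h1 s h, h1 t (h.trans hst)]
      exact hF.subordinate s t hs hst
    · rw [h2 s h h']
      rcases hcases t with ht | ⟨ht, ht'⟩ | ht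
      · rw [h1 t ht]
        exact (sF _ (by linarith)).trans (hF.subordinate U t hU0 ht)
      · rw [h2 t ht ht']
        exact sE _ _ (by linarith) (by linarith) (by linarith)
      · linarith
    · rw [h3 s h]
      rcases hcases t with ht | ⟨ht, ht'⟩ | ht
      · rw [h1 t ht]
        exact ((sψ s hs h.le).trans (sF b hb.le)).trans (hF.subordinate U t hU0 ht)
      · rw [h2 t ht ht']
        exact (sψ s hs h.le).trans (sE _ _ (by linarith) (by linarith) le_rfl)
      · rw [h3 t ht]
        refine ⟨dilatedTransition F T a s t, dilatedTransition_differentiableOn hF ha.le hs hst,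
          dilatedTransition_mapsTo hF hT ha.le hsq hs hst ht.le,
          dilatedTransition_zero hF ha.le hs hst, fun z hz => ?_⟩
        simp only
        rw [dilatedTransition_dilatedTransition hF ha.le hs hst ht.le hz]

/-- A chain that is squeezed on a time interval can be perturbed, at a later time of the interval,
in the direction of any holomorphic map of order at least two. -/
theorem exists_mem_classS0_of_squeezing (hF : IsLoewnerChain F) (hbd : IsTailBounded F)
    (hT : 0 ≤ T) (ha : 0 < a) (hTA : T < A)
    (hsq : ∀ s t, T ≤ s → s < t → t ≤ A + timeLead T a A → ∀ z ∈ unitBall n,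
      ‖transition F s t z‖ ≤ Real.exp (a * (s - t)) * ‖z‖)
    {g : Cn n → Cn n} (hg : DifferentiableOn ℂ g (unitBall n)) (hg0 : g 0 = 0)
    (hg' : HasFDerivAt g (0 : Cn n →L[ℂ] Cn n) 0) :
    ∃ ε₀ > 0, ∀ ε : ℂ, ‖ε‖ ≤ ε₀ → ∀ h : Hol n,
      EqOn h (fun z => F 0 z + ε • g (transition F 0 (A + timeLead T a A) z)) (unitBall n) →
        h ∈ classS0 n := by
  have hb : 0 < timeLead T a A := by
    rw [timeLead_of_ge hTA.le]; exact mul_pos ha (by linarith)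
  have hA : 0 < A := hT.trans_lt hTA
  set b := timeLead T a A with hbdef
  set U := A + b with hU
  have hU0 : 0 ≤ U := by linarith
  set ρ := Real.exp (-b) with hρ
  have hρ0 : 0 < ρ := Real.exp_pos _
  have hρ1 : ρ < 1 := by rw [hρ]; simpa using hb
  set η := 1 / (1 / b + 3) with hη
  have hη0 : 0 < η := by positivity
  have hηb : η * (1 / b + 3) ≤ 1 := by
    rw [hη, one_div_mul_cancel (by positivity)]
  obtain ⟨ε₀, hε₀, hκ⟩ := exists_factor_of_perturbation (hF.differentiableOn U hU0)
    (hF.injOn U hU0) (fun z hz => hF.injective_fderiv hbd hU0 hz) hg hρ1 hη0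
  refine ⟨ε₀, hε₀, fun ε hε h hh => ?_⟩
  obtain ⟨κ, hκd, hκm, hκe, hκL⟩ := hκ ε hε
  have h0ρ : (0 : Cn n) ∈ Metric.ball (0 : Cn n) ρ := Metric.mem_ball_self hρ0
  have hscale : ∀ z ∈ unitBall n, ρ • z ∈ Metric.ball (0 : Cn n) ρ := by
    intro z hz
    rw [mem_ball_zero_iff] at hz ⊢
    rw [norm_smul, Real.norm_of_nonneg hρ0.le]
    calc _ < ρ * 1 := by gcongr
      _ = ρ := mul_one ρ
  have hκ0 : κ 0 = 0 := by
    refine hF.injOn U hU0 (hκm h0ρ) (zero_mem_unitBall n) ?_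
    rw [hκe 0 h0ρ, hg0, smul_zero, add_zero]
  have hκ' : HasFDerivAt κ (ContinuousLinearMap.id ℂ (Cn n)) 0 := by
    have hd := (hκd.differentiableAt (Metric.isOpen_ball.mem_nhds h0ρ)).hasFDerivAt
    have h1 : HasFDerivAt (F U) (((Real.exp U : ℝ) : ℂ) • ContinuousLinearMap.id ℂ (Cn n)) (κ 0) := by
      rw [hκ0]; exact hF.hasFDerivAt U hU0
    have h2 := h1.comp (0 : Cn n) hd
    have h3 : HasFDerivAt (F U ∘ κ)
        (((Real.exp U : ℝ) : ℂ) • ContinuousLinearMap.id ℂ (Cn n)) 0 := by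
      have h4 := (hF.hasFDerivAt U hU0).add (hg'.const_smul ε)
      rw [smul_zero, add_zero] at h4
      refine h4.congr_of_eventuallyEq ?_
      filter_upwards [Metric.isOpen_ball.mem_nhds h0ρ] with w hw using hκe w hw
    have h4 := h2.unique h3
    have hne : ((Real.exp U : ℝ) : ℂ) ≠ 0 := by exact_mod_cast (Real.exp_pos U).ne'
    convert hd using 1
    ext1 v
    have h5 := congrArg (fun D => ((Real.exp U : ℝ) : ℂ)⁻¹ • D v) h4
    simp only [ContinuousLinearMap.comp_apply, smul_apply,
      ContinuousLinearMap.id_apply, smul_smul, inv_mul_cancel₀ hne, one_smul] at h5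
    rw [h5, ContinuousLinearMap.id_apply]
  -- in these coordinates the perturbed map is `e^{-b} (id + k)`
  let k : Cn n → Cn n := fun z => Real.exp b • κ (ρ • z) - z
  have hρb : Real.exp b * ρ = 1 := by rw [hρ, ← Real.exp_add]; simp
  have hk : DifferentiableOn ℂ k (unitBall n) :=
    ((hκd.comp (differentiableOn_id.const_smul ρ) hscale).const_smul (Real.exp b)).sub
      differentiableOn_id
  have hk0 : k 0 = 0 := by simp [k, hκ0]
  have hk' : HasFDerivAt k (0 : Cn n →L[ℂ] Cn n) 0 := by
    have h1 : HasFDerivAt κ (((1 : ℝ) : ℂ) • ContinuousLinearMap.id ℂ (Cn n)) 0 := by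
      simpa using hκ'
    have h2 := (hasFDerivAt_real_smul (Real.exp b) 0).comp_smul_id
      (h1.comp_smul_id (hasFDerivAt_real_smul ρ 0) (smul_zero _)) (by rw [smul_zero, hκ0])
    rw [one_mul, hρb, Complex.ofReal_one, one_smul] at h2
    have h3 := h2.sub (hasFDerivAt_id (𝕜 := ℂ) (0 : Cn n))
    rw [sub_self] at h3
    exact h3
  have hL : ∀ z ∈ unitBall n, ∀ w ∈ unitBall n, ‖k z - k w‖ ≤ η * ‖z - w‖ := by
    intro z hz w hw
    have h1 := hκL _ (hscale z hz) _ (hscale w hw)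
    rw [← smul_sub, norm_smul, Real.norm_of_nonneg hρ0.le] at h1
    have h2 : k z - k w = Real.exp b • ((κ (ρ • z) - ρ • z) - (κ (ρ • w) - ρ • w)) := by
      simp only [k, smul_sub, smul_smul, hρb, one_smul]
    rw [h2, norm_smul, Real.norm_of_nonneg (Real.exp_pos b).le]
    calc _ ≤ Real.exp b * (η * (ρ * ‖z - w‖)) := by gcongr
      _ = (Real.exp b * ρ) * (η * ‖z - w‖) := by ring
      _ = _ := by rw [hρb, one_mul]
  have hchain := hF.isLoewnerChain_perturbedChain hT ha hTA hsq hk hk0 hk' hL hη0 hηb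
  refine hchain.mem_classS0 ?_ ?_
  · obtain ⟨V, M, hV, hM0, hM⟩ := hbd
    refine ⟨max V U, M, hV.trans (le_max_left _ _), hM0, fun t ht z hz => ?_⟩
    rw [perturbedChain, if_pos ((le_max_right _ _).trans ht)]
    exact hM t ((le_max_left _ _).trans ht) z hz
  · intro z hz
    rw [hh hz, perturbedChain, if_neg (not_le.2 (by linarith)), if_neg (not_le.2 hA)]
    have hd0 : timeLead T a 0 = 0 := timeLead_of_le hT
    have h1 : dilatedTransition F T a 0 A z = Real.exp b • transition F 0 U z := by
      rw [dilatedTransition, hd0, add_zero, neg_zero, Real.exp_zero, one_smul]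
    have hφ := hF.transition_mapsTo le_rfl hU0 hz
    have hwρ : ρ • dilatedTransition F T a 0 A z = transition F 0 U z := by
      rw [h1, smul_smul, mul_comm, hρb, one_smul]
    have hwB : dilatedTransition F T a 0 A z ∈ unitBall n :=
      dilatedTransition_mapsTo hF hT ha.le hsq le_rfl hA.le le_rfl hz
    have h2 : interpolation k b b (dilatedTransition F T a 0 A z) = κ (transition F 0 U z) := by
      simp only [interpolation, k, div_self hb.ne', one_smul, add_sub_cancel, smul_smul]
      rw [← hρ, mul_comm, hρb, one_smul, hwρ]
    rw [h2, hκe _ (hwρ ▸ hscale _ hwB), hF.apply_transition le_rfl hU0 hz]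

end IsLoewnerChain

/-! ### Functionals that annihilate compositions with a transition map -/

section HolSpace

variable {n : ℕ}

theorem Hol.apply_eq (g : Hol n) (z : unitBall n) : g (z : Cn n) = (g : C(unitBall n, Cn n)) z :=
  zeroExt_apply _ z

theorem Hol.eq_of_eqOn {g h : Hol n} (H : EqOn g h (unitBall n)) : g = h := by
  refine Subtype.ext (ContinuousMap.ext fun z => ?_)
  rw [← Hol.apply_eq, ← Hol.apply_eq]
  exact H z.2

theorem Hol.add_apply (g h : Hol n) {z : Cn n} (hz : z ∈ unitBall n) : (g + h) z = g z + h z := by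
  have := Hol.apply_eq (g + h) ⟨z, hz⟩
  rw [this, Submodule.coe_add, ContinuousMap.add_apply, ← Hol.apply_eq, ← Hol.apply_eq]

theorem Hol.smul_apply (c : ℂ) (g : Hol n) {z : Cn n} (hz : z ∈ unitBall n) :
    (c • g) z = c • g z := by
  have := Hol.apply_eq (c • g) ⟨z, hz⟩
  rw [this, Submodule.coe_smul, ContinuousMap.smul_apply, ← Hol.apply_eq]

theorem Hol.sub_apply (g h : Hol n) {z : Cn n} (hz : z ∈ unitBall n) : (g - h) z = g z - h z := by
  have e : g - h + h = g := sub_add_cancel g h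
  rw [eq_sub_iff_add_eq, ← Hol.add_apply _ _ hz, e]

theorem Hol.tendsto_iff_tendstoUniformlyOn {ι : Type*} {l : Filter ι} {u : ι → Hol n} {g : Hol n} :
    Tendsto u l (𝓝 g) ↔ ∀ r < 1,
      TendstoUniformlyOn (fun i => (u i : Cn n → Cn n)) g l (Metric.closedBall 0 r) := by
  rw [Topology.IsInducing.subtypeVal.tendsto_nhds_iff,
    ContinuousMap.tendsto_iff_forall_isCompact_tendstoUniformlyOn]
  simp only [Metric.tendstoUniformlyOn_iff]
  constructor
  · intro H r hr ε hε
    have hsub : Metric.closedBall (0 : Cn n) r ⊆ unitBall n := Metric.closedBall_subset_ball hr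
    have hc : IsCompact ((Subtype.val : unitBall n → Cn n) ⁻¹' Metric.closedBall 0 r) :=
      Topology.IsInducing.subtypeVal.isCompact_preimage' (isCompact_closedBall _ _)
        (by rw [Subtype.range_val]; exact hsub)
    filter_upwards [H _ hc ε hε] with i hi z hz
    have := hi ⟨z, hsub hz⟩ hz
    rwa [Function.comp_apply, ← Hol.apply_eq, ← Hol.apply_eq] at this
  · intro H K hK ε hε
    obtain ⟨r, hr, hKr⟩ : ∃ r < 1, ∀ z ∈ K, ‖(z : Cn n)‖ ≤ r := by
      rcases K.eq_empty_or_nonempty with rfl | hne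
      · exact ⟨0, one_pos, by simp⟩
      · obtain ⟨z, hz, hmax⟩ := hK.exists_isMaxOn hne
          (continuous_subtype_val.norm : Continuous fun z : unitBall n => ‖(z : Cn n)‖).continuousOn
        exact ⟨_, mem_ball_zero_iff.1 z.2, hmax⟩
    filter_upwards [H r hr ε hε] with i hi z hz
    have := hi z (mem_closedBall_zero_iff.2 (hKr z hz))
    rwa [Hol.apply_eq, Hol.apply_eq] at this

open Classical in
/-- The element of `Hol(𝔹ⁿ, ℂⁿ)` given by a function that is holomorphic on the ball
(zero for other functions). -/
noncomputable def holOf (f : Cn n → Cn n) : Hol n :=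
  if h : DifferentiableOn ℂ f (unitBall n) then (exists_hol_eqOn h).choose else 0

theorem holOf_eqOn {f : Cn n → Cn n} (h : DifferentiableOn ℂ f (unitBall n)) :
    EqOn (holOf f) f (unitBall n) := by
  rw [holOf, dif_pos h]
  exact (exists_hol_eqOn h).choose_spec

/-- A continuous functional on `Hol(𝔹ⁿ, ℂⁿ)` is bounded by a multiple of the supremum norm over
some smaller ball. -/
theorem exists_bound_of_continuousLinearMap (L : Hol n →L[ℂ] ℂ) :
    ∃ ρ C : ℝ, 0 < ρ ∧ ρ < 1 ∧ 0 ≤ C ∧ ∀ (g : Hol n) (M : ℝ),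
      (∀ z ∈ Metric.ball (0 : Cn n) ρ, ‖g z‖ ≤ M) → ‖L g‖ ≤ C * M := by
  obtain ⟨N, hN⟩ : ∃ N : ℕ, ∀ g : Hol n,
      (∀ z ∈ Metric.ball (0 : Cn n) (1 - 1 / ((N : ℝ) + 2)), ‖g z‖ ≤ 1 / ((N : ℝ) + 1)) →
        ‖L g‖ < 1 := by
    by_contra! H
    choose u hu hLu using H
    have hlim : Tendsto u atTop (𝓝 0) := by
      rw [Hol.tendsto_iff_tendstoUniformlyOn]
      intro r hr
      rw [Metric.tendstoUniformlyOn_iff]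
      intro ε hε
      have h1 : Tendsto (fun N : ℕ => 1 - 1 / ((N : ℝ) + 2)) atTop (𝓝 1) := by
        have := (tendsto_const_nhds (x := (1 : ℝ))).sub
          ((tendsto_add_atTop_iff_nat 1).2 (tendsto_one_div_add_atTop_nhds_zero_nat (𝕜 := ℝ)))
        rw [sub_zero] at this
        refine this.congr fun N => ?_
        push_cast
        rw [add_assoc, one_add_one_eq_two]
      filter_upwards [h1.eventually (lt_mem_nhds hr),
        (tendsto_one_div_add_atTop_nhds_zero_nat (𝕜 := ℝ)).eventually (gt_mem_nhds hε)]
        with N hN1 hN2 z hz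
      have hzB : z ∈ unitBall n := Metric.closedBall_subset_ball hr hz
      have h0 : (0 : Hol n) z = 0 := Hol.apply_eq 0 ⟨z, hzB⟩
      rw [h0, dist_zero_left]
      exact (hu N z (Metric.closedBall_subset_ball hN1 hz)).trans_lt hN2
    have h2 := (L.continuous.tendsto 0).comp hlim
    rw [map_zero] at h2
    obtain ⟨N, hN⟩ := (h2.norm.eventually (gt_mem_nhds (by simp : ‖(0 : ℂ)‖ < 1))).exists
    exact absurd hN (not_lt.2 (hLu N))
  have hN2 : 1 / ((N : ℝ) + 2) < 1 := by
    rw [div_lt_one (by positivity)]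
    linarith [Nat.cast_nonneg (α := ℝ) N]
  refine ⟨1 - 1 / ((N : ℝ) + 2), N + 1, by linarith,
    by linarith [show 0 < 1 / ((N : ℝ) + 2) by positivity], by positivity, fun g M hg => ?_⟩
  have hM : 0 ≤ M := (norm_nonneg _).trans (hg 0 (Metric.mem_ball_self (by linarith)))
  refine le_of_forall_pos_lt_add fun ε hε => ?_
  set c : ℝ := (N + 1) * M + ε with hc
  have hc0 : 0 < c := by positivity
  have h := hN (((c : ℝ) : ℂ)⁻¹ • g) fun z hz => ?_
  · rw [map_smul, norm_smul, norm_inv, Complex.norm_real, Real.norm_of_nonneg hc0.le,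
      inv_mul_lt_iff₀ hc0, mul_one] at h
    exact h
  · have hzB : z ∈ unitBall n :=
      Metric.ball_subset_ball (by linarith [show 0 < 1 / ((N : ℝ) + 2) by positivity]) hz
    rw [Hol.smul_apply _ _ hzB, norm_smul, norm_inv, Complex.norm_real, Real.norm_of_nonneg hc0.le,
      inv_mul_le_iff₀ hc0, mul_one_div, le_div_iff₀ (by positivity)]
    have := hg z hz
    calc ‖g z‖ * ((N : ℝ) + 1) ≤ M * (N + 1) := by gcongr
      _ ≤ c := by rw [hc]; linarith

end HolSpace

/-- A function with `‖f s - f t‖ ≤ D (T - s)ʲ (t - s)` that vanishes at `T` satisfies the integrated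
estimate. -/
theorem norm_le_of_norm_sub_le_pow {f : ℝ → ℂ} {T D : ℝ} {j : ℕ} (hD : 0 ≤ D) (hfT : f T = 0)
    (hf : ∀ s t, 0 ≤ s → s ≤ t → t ≤ T → ‖f s - f t‖ ≤ D * (T - s) ^ j * (t - s)) {s : ℝ}
    (hs : 0 ≤ s) (hsT : s ≤ T) : ‖f s‖ ≤ D * ((T - s) ^ (j + 1) / (j + 1)) := by
  have hT : 0 ≤ T := hs.trans hsT
  have hlip : ∀ x y, 0 ≤ x → x ≤ y → y ≤ T →
      ‖f (T - y) - f (T - x)‖ ≤ D * y ^ j * (y - x) := by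
    intro x y hx hxy hy
    have := hf (T - y) (T - x) (by linarith) (by linarith) (by linarith)
    rwa [show T - (T - y) = y by ring, show T - x - (T - y) = y - x by ring] at this
  have hcont : ContinuousOn (fun u => ‖f (T - u)‖) (Icc 0 T) := by
    refine ContinuousOn.norm (LipschitzOnWith.continuousOn (K := (D * T ^ j).toNNReal)
      (LipschitzOnWith.of_dist_le_mul fun x hx y hy => ?_))
    rw [Real.coe_toNNReal _ (by positivity), dist_eq_norm, Real.dist_eq]
    have key : ∀ x y, 0 ≤ x → x ≤ y → y ≤ T → ‖f (T - y) - f (T - x)‖ ≤ D * T ^ j * (y - x) := by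
      intro x y hx hxy hy
      refine (hlip x y hx hxy hy).trans (mul_le_mul_of_nonneg_right ?_ (by linarith))
      have : 0 ≤ y := hx.trans hxy
      gcongr
    rcases le_total x y with h | h
    · rw [norm_sub_rev, abs_sub_comm, abs_of_nonneg (by linarith)]
      exact key x y hx.1 h hy.2
    · rw [abs_of_nonneg (by linarith)]
      exact key y x hy.1 h hx.2
  have hder : ∀ x : ℝ, HasDerivAt (fun u : ℝ => D * (u ^ (j + 1) / (j + 1))) (D * x ^ j) x := by
    intro x
    have h := ((hasDerivAt_pow (j + 1) x).div_const ((j : ℝ) + 1)).const_mul D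
    refine h.congr_deriv ?_
    have : (j : ℝ) + 1 ≠ 0 := by positivity
    rw [Nat.cast_succ, Nat.add_sub_cancel, mul_div_cancel_left₀ _ this]
  have key := image_le_of_liminf_slope_right_le_deriv_boundary (f := fun u => ‖f (T - u)‖)
    (a := 0) (b := T) (B := fun u => D * (u ^ (j + 1) / (j + 1))) (B' := fun u => D * u ^ j)
    hcont (by simp [hfT]) (fun x _ => (hder x).continuousAt.continuousWithinAt)
    (fun x _ => (hder x).hasDerivWithinAt) (fun x hx r hr => ?_) (x := T - s)
    ⟨by linarith, by linarith⟩
  · simpa using key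
  · refine Eventually.frequently ?_
    have hc : ContinuousAt (fun y : ℝ => D * y ^ j) x := by fun_prop
    filter_upwards [self_mem_nhdsWithin, mem_nhdsWithin_of_mem_nhds (hc.eventually (gt_mem_nhds hr)),
      mem_nhdsWithin_of_mem_nhds (Iio_mem_nhds hx.2)] with y (hy : x < y) hyr (hyT : y < T)
    refine lt_of_le_of_lt ?_ hyr
    rw [slope_def_field, div_le_iff₀ (by linarith)]
    exact (norm_sub_norm_le _ _).trans (hlip x y hx.1 hy.le hyT.le)

/-- Holomorphic maps on the ball that vanish to second order at the origin. -/
structure VanishesToOrderTwo {n : ℕ} (g : Cn n → Cn n) : Prop where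
  differentiableOn : DifferentiableOn ℂ g (unitBall n)
  map_zero : g 0 = 0
  hasFDerivAt : HasFDerivAt g (0 : Cn n →L[ℂ] Cn n) 0

namespace IsLoewnerChain

variable {n : ℕ} {F : ℝ → Cn n → Cn n} {s t T : ℝ}

theorem differentiableOn_comp_transition (hF : IsLoewnerChain F) (hs : 0 ≤ s) (hst : s ≤ t)
    {g : Cn n → Cn n} (hg : DifferentiableOn ℂ g (unitBall n)) :
    DifferentiableOn ℂ (fun z => g (transition F s t z)) (unitBall n) :=
  hg.comp (hF.transition_differentiableOn hs hst) (hF.transition_mapsTo hs hst)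

theorem vanishesToOrderTwo_sub_comp (hF : IsLoewnerChain F) (hs : 0 ≤ s) (hst : s ≤ t)
    {g : Cn n → Cn n} (hg : VanishesToOrderTwo g) :
    VanishesToOrderTwo fun z => g z - g (transition F s t z) := by
  refine ⟨hg.differentiableOn.sub (hF.differentiableOn_comp_transition hs hst hg.differentiableOn),
    ?_, ?_⟩
  · beta_reduce
    rw [hF.transition_zero hs hst, sub_self]
  · have h1 : HasFDerivAt g (0 : Cn n →L[ℂ] Cn n) (transition F s t 0) := by
      rw [hF.transition_zero hs hst]; exact hg.hasFDerivAt
    have h2 := hg.hasFDerivAt.sub (h1.comp (0 : Cn n) (hF.transition_hasFDerivAt hs hst))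
    rw [ContinuousLinearMap.zero_comp, sub_zero] at h2
    exact h2

theorem apply_comp_sub_apply_comp (hF : IsLoewnerChain F) (L : Hol n →L[ℂ] ℂ) (hs : 0 ≤ s)
    (hst : s ≤ t) {g : Cn n → Cn n} (hg : VanishesToOrderTwo g) :
    L (holOf fun z => g (transition F 0 s z)) - L (holOf fun z => g (transition F 0 t z)) =
      L (holOf fun z => g (transition F 0 s z) -
        g (transition F s t (transition F 0 s z))) := by
  rw [← map_sub]
  congr 1
  refine Hol.eq_of_eqOn fun z hz => ?_
  rw [Hol.sub_apply _ _ hz,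
    holOf_eqOn (hF.differentiableOn_comp_transition le_rfl hs hg.differentiableOn) hz,
    holOf_eqOn (hF.differentiableOn_comp_transition le_rfl (hs.trans hst) hg.differentiableOn) hz,
    holOf_eqOn (hF.differentiableOn_comp_transition le_rfl hs
      (hF.vanishesToOrderTwo_sub_comp hs hst hg).differentiableOn) hz]
  beta_reduce
  rw [hF.transition_transition le_rfl hs hst hz]

/-- Iterated estimates, on an increasing scale of balls, for a functional that annihilates the
compositions with the transition map at time `T`. -/
theorem norm_apply_comp_le (hF : IsLoewnerChain F) {L : Hol n →L[ℂ] ℂ} {ρ C : ℝ}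
    (hC : 0 ≤ C) (hL : ∀ (g : Hol n) (M : ℝ),
      (∀ z ∈ Metric.ball (0 : Cn n) ρ, ‖g z‖ ≤ M) → ‖L g‖ ≤ C * M)
    (hT : ∀ g, VanishesToOrderTwo g → L (holOf fun z => g (transition F 0 T z)) = 0)
    (hρ0 : 0 < ρ) {ρ₁ δ : ℝ} (hρ₁ : ρ₁ < 1) (hδ : 0 < δ) (j : ℕ) (hj : ρ + j * δ ≤ ρ₁) (hs : 0 ≤ s)
    (hsT : s ≤ T) {g : Cn n → Cn n} (hg : VanishesToOrderTwo g) {M : ℝ}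
    (hM : ∀ z ∈ Metric.ball (0 : Cn n) (ρ + j * δ), ‖g z‖ ≤ M) :
    ‖L (holOf fun z => g (transition F 0 s z))‖ ≤
      C * M * (16 / (1 - ρ₁) ^ 2 / δ) ^ j * ((T - s) ^ j / j.factorial) := by
  have hρ₁' : 0 < 1 - ρ₁ := by linarith
  induction j generalizing s g M with
  | zero =>
    simp only [Nat.cast_zero, zero_mul, add_zero] at hM hj
    simp only [pow_zero, Nat.factorial_zero, Nat.cast_one, div_one, mul_one]
    refine hL _ M fun z hz => ?_
    have hzB : z ∈ unitBall n := Metric.ball_subset_ball (by linarith) hz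
    rw [holOf_eqOn (hF.differentiableOn_comp_transition le_rfl hs hg.differentiableOn) hzB]
    exact hM _ (mem_ball_zero_iff.2 ((hF.norm_transition_le le_rfl hs hzB).trans_lt
      (mem_ball_zero_iff.1 hz)))
  | succ j ih =>
    have hRj : ρ + ((j + 1 : ℕ) : ℝ) * δ = ρ + j * δ + δ := by push_cast; ring
    rw [hRj] at hM hj
    have hjδ : 0 ≤ j * δ := by positivity
    have hM0 : 0 ≤ M := (norm_nonneg _).trans (hM 0 (Metric.mem_ball_self (by linarith)))
    have hR1 : Metric.ball (0 : Cn n) (ρ + j * δ + δ) ⊆ unitBall n :=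
      Metric.ball_subset_ball (by linarith)
    have key := norm_le_of_norm_sub_le_pow
      (f := fun s => L (holOf fun z => g (transition F 0 s z))) (T := T) (j := j)
      (D := C * M * (16 / (1 - ρ₁) ^ 2 / δ) ^ (j + 1) / j.factorial) (by positivity) (hT g hg)
      (fun s t hs hst htT => ?_) hs hsT
    · refine key.trans (le_of_eq ?_)
      rw [Nat.factorial_succ]
      push_cast
      have : (j : ℝ) + 1 ≠ 0 := by positivity
      have : (j.factorial : ℝ) ≠ 0 := by positivity
      field_simp
    · beta_reduce
      rw [hF.apply_comp_sub_apply_comp L hs hst hg]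
      refine (ih (by linarith) hs (hst.trans htT) (hF.vanishesToOrderTwo_sub_comp hs hst hg)
        (M := 2 * M / δ * ((t - s) * (8 / (1 - ρ₁) ^ 2))) fun z hz => ?_).trans (le_of_eq ?_)
      · rw [mem_ball_zero_iff] at hz
        have hzB : z ∈ unitBall n := mem_ball_zero_iff.2 (by linarith)
        have h1 := norm_sub_le_of_norm_le_on_ball (r := ρ + j * δ) (by linarith)
          (hg.differentiableOn.mono hR1) hM (mem_closedBall_zero_iff.2 hz.le)
          (mem_closedBall_zero_iff.2 ((hF.norm_transition_le hs hst hzB).trans hz.le))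
        rw [add_sub_cancel_left] at h1
        refine h1.trans (mul_le_mul_of_nonneg_left ?_ (by positivity))
        exact hF.norm_sub_transition_le hs hst hρ₁ (by linarith)
      · have : (j.factorial : ℝ) ≠ 0 := by positivity
        rw [show 16 / (1 - ρ₁) ^ 2 / δ = 2 * (8 / (1 - ρ₁) ^ 2) / δ by ring]
        generalize 8 / (1 - ρ₁) ^ 2 = P
        rw [pow_succ]
        field_simp

/-- The density of the compositions with a transition map: a continuous functional that annihilates
all `g ∘ F_T⁻¹ ∘ F_0`, with `g` of order at least two at the origin, annihilates all such `g`. -/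
theorem apply_eq_zero_of_apply_comp_eq_zero (hF : IsLoewnerChain F) (L : Hol n →L[ℂ] ℂ)
    (hT0 : 0 ≤ T) (hT : ∀ g, VanishesToOrderTwo g → L (holOf fun z => g (transition F 0 T z)) = 0)
    {g : Cn n → Cn n} (hg : VanishesToOrderTwo g) : L (holOf g) = 0 := by
  obtain ⟨ρ, C, hρ0, hρ1, hC, hL⟩ := exists_bound_of_continuousLinearMap L
  set ρ₁ := (1 + ρ) / 2 with hρ₁
  have hρ₁1 : ρ₁ < 1 := by linarith
  have hgap : 0 < ρ₁ - ρ := by linarith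
  set K := 16 / (1 - ρ₁) ^ 2 with hK
  have hK0 : 0 < K := by
    have : 0 < 1 - ρ₁ := by linarith
    positivity
  set θ := (ρ₁ - ρ) / (2 * Real.exp 1 * K) with hθ
  have hE := Real.exp_pos 1
  have hθ0 : 0 < θ := by positivity
  -- the length `θ` of the backward step does not depend on the time
  have hstep : ∀ T, (∀ g, VanishesToOrderTwo g → L (holOf fun z => g (transition F 0 T z)) = 0) →
      ∀ s, 0 ≤ s → s ≤ T → T - s ≤ θ → ∀ g, VanishesToOrderTwo g →
        L (holOf fun z => g (transition F 0 s z)) = 0 := by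
    intro T hT s hs hsT hθs g hg
    obtain ⟨M, hM⟩ := (isCompact_closedBall (0 : Cn n) ρ₁).exists_bound_of_continuousOn
      (hg.differentiableOn.continuousOn.mono (Metric.closedBall_subset_ball hρ₁1))
    have hM0 : 0 ≤ M := (norm_nonneg _).trans (hM 0 (Metric.mem_closedBall_self (by linarith)))
    have hbound : ∀ N : ℕ, ‖L (holOf fun z => g (transition F 0 s z))‖ ≤
        C * M * (1 / 2) ^ (N + 1) := by
      intro N
      have hN : (0 : ℝ) < (N + 1 : ℕ) := by positivity
      have hj : ρ + ((N + 1 : ℕ) : ℝ) * ((ρ₁ - ρ) / (N + 1 : ℕ)) = ρ₁ := by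
        rw [mul_div_cancel₀ _ hN.ne']; ring
      have h1 := hF.norm_apply_comp_le hC hL hT hρ0 hρ₁1 (δ := (ρ₁ - ρ) / (N + 1 : ℕ))
        (by positivity) (N + 1) hj.le hs hsT hg (M := M)
        (fun z hz => hM z (by rw [hj] at hz; exact Metric.ball_subset_closedBall hz))
      refine h1.trans ?_
      rw [mul_assoc (C * M)]
      refine mul_le_mul_of_nonneg_left ?_ (by positivity)
      have h2 := Real.pow_div_factorial_le_exp _ hN.le (N + 1)
      have hTs : 0 ≤ T - s := by linarith
      calc _ = (K / (ρ₁ - ρ) * (T - s)) ^ (N + 1) *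
            (((N + 1 : ℕ) : ℝ) ^ (N + 1) / (N + 1).factorial) := by
            rw [show 16 / (1 - ρ₁) ^ 2 / ((ρ₁ - ρ) / ((N + 1 : ℕ) : ℝ)) =
              K / (ρ₁ - ρ) * ((N + 1 : ℕ) : ℝ) by rw [hK, div_div_eq_mul_div]; ring]
            rw [mul_pow, mul_pow]
            ring
        _ ≤ (K / (ρ₁ - ρ) * θ) ^ (N + 1) * Real.exp ((N + 1 : ℕ) : ℝ) := by gcongr
        _ = (K / (ρ₁ - ρ) * θ * Real.exp 1) ^ (N + 1) := by
            rw [mul_pow _ (Real.exp 1), ← Real.exp_nat_mul, mul_one]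
        _ = (1 / 2) ^ (N + 1) := by
            congr 1
            rw [hθ]
            clear_value K ρ₁
            field_simp
    have hlim : Tendsto (fun N : ℕ => C * M * (1 / 2 : ℝ) ^ (N + 1)) atTop (𝓝 0) := by
      have := ((tendsto_add_atTop_iff_nat 1).2 (tendsto_pow_atTop_nhds_zero_of_lt_one
        (by norm_num : (0 : ℝ) ≤ 1 / 2) (by norm_num))).const_mul (C * M)
      rwa [mul_zero] at this
    exact norm_le_zero_iff.1 (ge_of_tendsto' hlim hbound)
  have hiter : ∀ N : ℕ, ∀ g, VanishesToOrderTwo g →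
      L (holOf fun z => g (transition F 0 (max 0 (T - N * θ)) z)) = 0 := by
    intro N
    induction N with
    | zero => simpa [max_eq_right hT0] using hT
    | succ N ih =>
      have hle : T - ((N + 1 : ℕ) : ℝ) * θ ≤ T - N * θ := by push_cast; linarith
      refine hstep _ ih _ (le_max_left _ _) (max_le_max le_rfl hle) ?_
      have : max 0 (T - N * θ) ≤ max 0 (T - ((N + 1 : ℕ) : ℝ) * θ) + θ := by
        refine max_le (by linarith [le_max_left 0 (T - ((N + 1 : ℕ) : ℝ) * θ)]) ?_
        have := le_max_right 0 (T - ((N + 1 : ℕ) : ℝ) * θ)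
        push_cast at this ⊢
        linarith
      linarith
  obtain ⟨N, hN⟩ := exists_nat_ge (T / θ)
  rw [div_le_iff₀ hθ0] at hN
  have h := hiter N g hg
  rw [max_eq_left (by linarith)] at h
  rw [← h]
  congr 1
  refine Hol.eq_of_eqOn fun z hz => ?_
  rw [holOf_eqOn hg.differentiableOn hz,
    holOf_eqOn (hF.differentiableOn_comp_transition le_rfl le_rfl hg.differentiableOn) hz]
  beta_reduce
  rw [hF.transition_self le_rfl hz]

end IsLoewnerChain

/-! ### Support points and extreme points -/

section NormalChain

variable {n : ℕ} {f : ℝ≥0 → Hol n}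

/-- A chain indexed by `ℝ≥0` as a family of functions indexed by the real line. -/
noncomputable def realChain (f : ℝ≥0 → Hol n) (t : ℝ) : Cn n → Cn n := f t.toNNReal

theorem isLoewnerChain_realChain (hf : IsNormalLoewnerChain f) : IsLoewnerChain (realChain f) where
  differentiableOn t _ := Hol.differentiableOn _
  map_zero t _ := (hf.1.1.1 _).1
  hasFDerivAt t ht := by
    have h := (hf.1.1.1 t.toNNReal).2
    rw [Real.coe_toNNReal t ht] at h
    have e : ((Real.exp t : ℝ) : ℂ) • ContinuousLinearMap.id ℂ (Cn n) =
        Real.exp t • ContinuousLinearMap.id ℂ (Cn n) := by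
      ext1 v
      rw [IsLoewnerChain.ofReal_smul_id_apply]
      rfl
    rw [e]
    exact h
  injOn t _ := hf.1.2 _
  subordinate s t _ hst := by
    obtain ⟨φ, hm, h0, he⟩ := hf.1.1.2 s.toNNReal t.toNNReal (Real.toNNReal_le_toNNReal hst)
    exact ⟨φ, Hol.differentiableOn φ, hm, h0, he⟩

/-- Montel's criterion in the easy direction: a normal family is bounded on compact sets. -/
theorem isTailBounded_realChain (hf : IsNormalLoewnerChain f) : IsTailBounded (realChain f) := by
  have hsub : Metric.closedBall (0 : Cn n) (1 / 2) ⊆ unitBall n :=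
    Metric.closedBall_subset_ball (by norm_num)
  obtain ⟨M, hM⟩ : ∃ M : ℕ, ∀ t : ℝ≥0, ∀ z ∈ Metric.closedBall (0 : Cn n) (1 / 2),
      ‖(Real.exp (-(t : ℝ)) • f t : Hol n) z‖ ≤ M := by
    by_contra! H
    choose t z hz ht using H
    obtain ⟨g, σ, hσ, hlim⟩ := hf.2 (fun k => Real.exp (-(t k : ℝ)) • f (t k)) fun k => ⟨t k, rfl⟩
    have hu := Hol.tendsto_iff_tendstoUniformlyOn.1 hlim (1 / 2) (by norm_num)
    obtain ⟨B, hB⟩ := (isCompact_closedBall (0 : Cn n) (1 / 2)).exists_bound_of_continuousOn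
      ((Hol.differentiableOn g).continuousOn.mono hsub)
    have hev := Metric.tendstoUniformlyOn_iff.1 hu 1 one_pos
    obtain ⟨K, hK⟩ := exists_nat_ge (B + 1)
    obtain ⟨k, hk, hkK⟩ := (hev.and (eventually_ge_atTop K)).exists
    have h1 := hk (z (σ k)) (hz (σ k))
    have h2 := ht (σ k)
    have h3 := hB _ (hz (σ k))
    rw [Function.comp_apply, dist_eq_norm, norm_sub_rev] at h1
    have h4 := norm_le_norm_sub_add
      ((Real.exp (-(t (σ k) : ℝ)) • f (t (σ k)) : Hol n) (z (σ k))) (g (z (σ k)))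
    have h5 : (K : ℝ) ≤ σ k := by exact_mod_cast hkK.trans (hσ.id_le k)
    linarith
  refine ⟨0, M, le_rfl, Nat.cast_nonneg M, fun t ht z hz => ?_⟩
  have hzB : z ∈ unitBall n := Metric.ball_subset_ball (by norm_num) hz
  have h := hM t.toNNReal z (Metric.ball_subset_closedBall hz)
  have h1 : (Real.exp (-(t.toNNReal : ℝ)) • f t.toNNReal : Hol n) =
      ((Real.exp (-t) : ℝ) : ℂ) • f t.toNNReal := by
    rw [Real.coe_toNNReal t ht]
    exact Subtype.ext (ContinuousMap.ext fun z => (Complex.coe_smul _ _).symm)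
  rw [h1, Hol.smul_apply _ _ hzB, norm_smul, Complex.norm_real,
    Real.norm_of_nonneg (Real.exp_pos _).le, Real.exp_neg, inv_mul_le_iff₀ (Real.exp_pos t)] at h
  exact h

/-- The initial element of a squeezed chain can be moved, within `S⁰`, in all directions
`g ∘ F_U⁻¹ ∘ F_0` for a suitable time `U`. -/
theorem exists_time_perturbation_mem_classS0 (hf : IsNormalLoewnerChain f) {T₁ : ℝ≥0} {T₂ : ℝ≥0∞}
    (hT : (T₁ : ℝ≥0∞) < T₂) (hsq : IsExponentiallySqueezing f T₁ T₂) :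
    ∃ U : ℝ, 0 ≤ U ∧ ∀ g, VanishesToOrderTwo g → ∃ ε₀ > 0, ∀ ε : ℂ, ‖ε‖ ≤ ε₀ →
      f 0 + ε • holOf (fun z => g (transition (realChain f) 0 U z)) ∈ classS0 n := by
  have hF := isLoewnerChain_realChain hf
  obtain ⟨a, ha, -, hsq⟩ := hsq
  obtain ⟨V, hTV, hVT⟩ := ENNReal.lt_iff_exists_nnreal_btwn.1 hT
  have hTV' : (T₁ : ℝ) < V := by exact_mod_cast hTV
  -- `A` is chosen so that the accelerated clock reads `V` at time `A`
  set A : ℝ := T₁ + (V - T₁) / (1 + a) with hA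
  have hTA : (T₁ : ℝ) < A := by
    have : 0 < ((V : ℝ) - T₁) / (1 + a) := div_pos (by linarith) (by linarith)
    linarith
  have hU : A + IsLoewnerChain.timeLead (T₁ : ℝ) a A = V := by
    rw [IsLoewnerChain.timeLead_of_ge hTA.le, hA]
    field_simp
    ring
  have hsqF : ∀ s t, (T₁ : ℝ) ≤ s → s < t → t ≤ A + IsLoewnerChain.timeLead (T₁ : ℝ) a A →
      ∀ z ∈ unitBall n, ‖transition (realChain f) s t z‖ ≤ Real.exp (a * (s - t)) * ‖z‖ := by
    intro s t hs hst htV z hz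
    rw [hU] at htV
    have hs0 : 0 ≤ s := T₁.coe_nonneg.trans hs
    have ht0 : 0 ≤ t := hs0.trans hst.le
    have h1 : T₁ ≤ s.toNNReal := by rwa [← NNReal.coe_le_coe, Real.coe_toNNReal s hs0]
    have h2 : s.toNNReal < t.toNNReal := (Real.toNNReal_lt_toNNReal_iff (hs0.trans_lt hst)).2 hst
    have h3 : (t.toNNReal : ℝ≥0∞) < T₂ := by
      refine lt_of_le_of_lt ?_ hVT
      rw [ENNReal.coe_le_coe, ← NNReal.coe_le_coe, Real.coe_toNNReal t ht0]
      exact htV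
    obtain ⟨w, hw, hwe, hwn⟩ := hsq _ _ h1 h2 h3 z hz
    rw [Real.coe_toNNReal s hs0, Real.coe_toNNReal t ht0] at hwn
    rwa [hF.transition_eq ht0 hw hwe]
  refine ⟨V, V.coe_nonneg, fun g hg => ?_⟩
  obtain ⟨ε₀, hε₀, h⟩ := hF.exists_mem_classS0_of_squeezing (isTailBounded_realChain hf)
    T₁.coe_nonneg ha hTA hsqF hg.differentiableOn hg.map_zero hg.hasFDerivAt
  refine ⟨ε₀, hε₀, fun ε hε => h ε hε _ fun z hz => ?_⟩
  have hcomp := hF.differentiableOn_comp_transition le_rfl V.coe_nonneg hg.differentiableOn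
  rw [Hol.add_apply _ _ hz, Hol.smul_apply _ _ hz, holOf_eqOn hcomp hz, hU]
  simp [realChain]

theorem vanishesToOrderTwo_coe_sub {g h : Hol n} (hg : g ∈ classS n) (hh : h ∈ classS n) :
    VanishesToOrderTwo fun z => g z - h z := by
  refine ⟨(Hol.differentiableOn g).sub (Hol.differentiableOn h), ?_, ?_⟩
  · beta_reduce
    rw [hg.1, hh.1, sub_self]
  · have := hg.2.1.sub hh.2.1
    rw [sub_self] at this
    exact this

theorem vanishesToOrderTwo_coord_smul (i : Fin n) : VanishesToOrderTwo fun z : Cn n => z i • z := by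
  have hd : ∀ z : Cn n, HasFDerivAt (fun z : Cn n => z i • z)
      (z i • ContinuousLinearMap.id ℂ (Cn n) + (EuclideanSpace.proj (𝕜 := ℂ) i).smulRight z) z :=
    fun z => ((EuclideanSpace.proj (𝕜 := ℂ) i).hasFDerivAt (x := z)).smul (hasFDerivAt_id z)
  refine ⟨fun z _ => (hd z).differentiableAt.differentiableWithinAt, by simp, ?_⟩
  convert hd 0 using 1
  ext1 v
  simp

end NormalChain

theorem proposition1p1 (n : ℕ) (hn : 1 ≤ n) (f : ℝ≥0 → Hol n) (hf : IsNormalLoewnerChain f)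
    (T₁ : ℝ≥0) (T₂ : ℝ≥0∞) (hT : (T₁ : ℝ≥0∞) < T₂) (hsq : IsExponentiallySqueezing f T₁ T₂) :
    f 0 ∉ supportPoints (classS0 n) ∧ f 0 ∉ (classS0 n).extremePoints ℝ := by
  have hF := isLoewnerChain_realChain hf
  obtain ⟨U, hU, hpert⟩ := exists_time_perturbation_mem_classS0 hf hT hsq
  refine ⟨?_, ?_⟩
  · rintro ⟨-, L, ⟨g₁, hg₁, g₂, hg₂, hne⟩, hmax⟩
    have hzero : ∀ g, VanishesToOrderTwo g →
        L (holOf fun z => g (transition (realChain f) 0 U z)) = 0 := by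
      intro g hg
      obtain ⟨ε₀, hε₀, hmem⟩ := hpert g hg
      set h := holOf fun z => g (transition (realChain f) 0 U z)
      by_contra hL
      have hLpos : 0 < ‖L h‖ := norm_pos_iff.2 hL
      -- the direction in which `Re L` increases fastest
      have h1 := hmax _ (hmem ((((ε₀ / ‖L h‖ : ℝ)) : ℂ) * (starRingEnd ℂ) (L h)) (by
        rw [norm_mul, Complex.norm_real, RCLike.norm_conj, Real.norm_of_nonneg (by positivity),
          div_mul_cancel₀ _ hLpos.ne']))
      rw [map_add, map_smul, Complex.add_re, smul_eq_mul, mul_assoc, ← Complex.normSq_eq_conj_mul_self,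
        ← Complex.ofReal_mul, Complex.ofReal_re, Complex.normSq_eq_norm_sq] at h1
      have : 0 < ε₀ / ‖L h‖ * ‖L h‖ ^ 2 := by positivity
      linarith
    have h2 := hF.apply_eq_zero_of_apply_comp_eq_zero L hU hzero
      (vanishesToOrderTwo_coe_sub hg₁.1 hg₂.1)
    have h3 : holOf (fun z => g₁ z - g₂ z) = g₁ - g₂ := Hol.eq_of_eqOn fun z hz => by
      rw [holOf_eqOn (vanishesToOrderTwo_coe_sub hg₁.1 hg₂.1).differentiableOn hz,
        Hol.sub_apply _ _ hz]
    have h4 : L (g₁ - g₂) = L g₁ - L g₂ := map_sub L g₁ g₂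
    rw [h3, h4, sub_eq_zero] at h2
    exact hne h2
  · intro hext
    let i : Fin n := ⟨0, hn⟩
    obtain ⟨ε₀, hε₀, hmem⟩ := hpert _ (vanishesToOrderTwo_coord_smul i)
    set h := holOf fun z => transition (realChain f) 0 U z i • transition (realChain f) 0 U z with hh
    have hε : ‖((ε₀ : ℝ) : ℂ)‖ ≤ ε₀ := by rw [Complex.norm_real, Real.norm_of_nonneg hε₀.le]
    have h1 := hmem (ε₀ : ℂ) hε
    have h2 := hmem (-(ε₀ : ℂ)) (by rwa [norm_neg])
    have h3 : f 0 + (ε₀ : ℂ) • h = f 0 := by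
      refine (mem_extremePoints_iff_left.1 hext).2 _ h1 _ h2
        ⟨1 / 2, 1 / 2, by norm_num, by norm_num, by norm_num, ?_⟩
      module
    have hh0 : h = 0 := by
      have h4 : (ε₀ : ℂ) • h = 0 := by simpa using h3
      exact (smul_eq_zero.1 h4).resolve_left (by exact_mod_cast hε₀.ne')
    -- then one coordinate of the transition map vanishes, although its differential does not
    have hcoord : ∀ z ∈ unitBall n, transition (realChain f) 0 U z i = 0 := by
      intro z hz
      have h4 := holOf_eqOn (hF.differentiableOn_comp_transition le_rfl hU
        (vanishesToOrderTwo_coord_smul i).differentiableOn) hz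
      have h5 : (0 : Hol n) z = 0 := Hol.apply_eq 0 ⟨z, hz⟩
      change h z = _ at h4
      rw [hh0, h5] at h4
      have h6 := congrArg (fun w : Cn n => w i) h4
      simpa using h6.symm
    have hd1 := ((EuclideanSpace.proj (𝕜 := ℂ) i).hasFDerivAt
      (x := transition (realChain f) 0 U 0)).comp (0 : Cn n) (hF.transition_hasFDerivAt le_rfl hU)
    have hd2 : HasFDerivAt ((EuclideanSpace.proj (𝕜 := ℂ) i) ∘ transition (realChain f) 0 U)
        (0 : Cn n →L[ℂ] ℂ) 0 :=
      (hasFDerivAt_const (0 : ℂ) (0 : Cn n)).congr_of_eventuallyEq <| by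
        filter_upwards [unitBall_mem_nhds (zero_mem_unitBall n)] with z hz using hcoord z hz
    have h7 := congrArg (fun D => D (EuclideanSpace.single i (1 : ℂ))) (hd1.unique hd2)
    simp at h7
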